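/- Let $d\in\{2,3\}$, let $\Omega\subset\mathbb R^d$ be a bounded convex polygonal or polyhedral domain, let $\mathcal T_h$ be a conforming triangulation of $\overline\Omega$ into finitely many simplices (of any mesh size $h>0$), let $r\ge 2$ be an integer, and let $M,\lambda,\nu,\epsilon>0$. Write $(\cdot,\cdot)$ and $\|\cdot\|$ for the $L^2(\Omega)$ inner product and norm, and put $F(s)=\frac1{4\epsilon^2}(s^2-1)^2$. Consider the finite element spaces $$S_h^k=\{v\in C(\overline\Omega): v|_K\in P_k(K)\ \forall K\in\mathcal T_h\},\qquad \mathring S_h^{k}=\{q\in S_h^k:\textstyle\int_\Omega q=0\},\qquad \mathbf X_h^r=\{\mathbf v\in (S_h^r)^d:\mathbf v|_{\partial\Omega}=0\},$$ where $P_k(K)$ is the space of polynomials of degree at most $k$ on $K$, and the trilinear forms $$b(\phi,\mathbf v,w)=(\nabla\phi\cdot\mathbf v,w),\qquad \mathbf B(\mathbf u,\mathbf v,\mathbf w)=\tfrac12((\mathbf u\cdot\nabla)\mathbf v,\mathbf w)-\tfrac12((\mathbf u\cdot\nabla)\mathbf w,\mathbf v).$$ For a time step $\tau>0$, one step of the scheme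 takes $(\phi_h^n,\mu_h^n,\mathbf u_h^n,p_h^n)\in S_h^r\times S_h^r\times\mathbf X_h^r\times\mathring S_h^{r-1}$ to $(\phi_h^{n+1},\mu_h^{n+1},\mathbf u_h^{n+1},p_h^{n+1})$ in the same space, with an intermediate velocity $\tilde{\mathbf u}_h^{n+1}\in\mathbf X_h^r$, such that for all $(w_h,\varphi_h,\mathbf v_h,q_h)\in S_h^r\times S_h^r\times\mathbf X_h^r\times\mathring S_h^{r-1}$: Step 1: $$\Big(\tfrac{\phi_h^{n+1}-\phi_h^n}{\tau},w_h\Big)+b(\phi_h^{n+1},\mathbf u_h^n,w_h)+M(\nabla\mu_h^{n+1},\nabla w_h)=0,$$ $$(\mu_h^{n+1},\varphi_h)-\lambda(\nabla\phi_h^{n+1},\nabla\varphi_h)-\tfrac{\lambda}{\epsilon^2}\big((\phi_h^{n+1})^3-\phi_h^n,\varphi_h\big)=0;$$ Step 2: $$\Big(\tfrac{\tilde{\mathbf u}_h^{n+1}-\mathbf u_h^n}{\tau},\mathbf v_h\Big)+\mathbf B(\mathbf u_h^n,\tilde{\mathbf u}_h^{n+1},\mathbf v_h)+\nu(\nabla\tilde{\mathbf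 u}_h^{n+1},\nabla\mathbf v_h)+(\nabla p_h^n,\mathbf v_h)-b(\phi_h^{n+1},\mathbf v_h,\mu_h^{n+1})=0;$$ Step 3: $$\Big(\tfrac{\mathbf u_h^{n+1}-\tilde{\mathbf u}_h^{n+1}}{\tau},\mathbf v_h\Big)+\big(\nabla(p_h^{n+1}-p_h^n),\mathbf v_h\big)=0,\qquad(\nabla\cdot\mathbf u_h^{n+1},q_h)=0.$$ (The homogeneous Neumann conditions for $\phi_h^{n+1}$ and $\mu_h^{n+1}$ are imposed weakly, as the natural boundary conditions of Step 1; the boundary conditions of the velocities are contained in $\mathbf X_h^r$.) Let $(\phi_h^0,\mu_h^0,\mathbf u_h^0,p_h^0)\in S_h^r\times S_h^r\times\mathbf X_h^r\times\mathring S_h^{r-1}$ be initial data with $(F(\phi_h^0),1)+\|\phi_h^0\|_{H^1}+\|\mathbf u_h^0\|\le C$ for some constant $C$. Then for every $\tau>0$ the scheme has a solution: whenever levels $0,\dots,n$ starting from these initial data solve the scheme, there exists a level $(\phi_h^{n+1},\mu_h^{n+1},\mathbf u_h^{n+1},p_h^{n+1})$, with some $\tilde{\mathbf u}_h^{n+1}$,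 that solves the scheme from level $n$. Consequently there is a solution $(\phi_h^{n},\mu_h^{n},\mathbf u_h^{n},p_h^{n})_{n\ge0}$ at all time levels with these initial data. -/

import Mathlib

namespace CHNS

open MeasureTheory

/-- The ambient space `ℝᵈ` with its Euclidean structure. -/
abbrev Pt (d : ℕ) : Type := EuclideanSpace ℝ (Fin d)

/-! ### Domain, triangulation, finite element spaces -/

/-- `Ω` is a nonempty bounded open convex polygonal (`d = 2`) or polyhedral (`d = 3`) domain:
an open convex set whose closure is the convex hull of finitely many points. -/
structure IsConvexPolytopalDomain {d : ℕ} (Ω : Set (Pt d)) : Prop where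
  isOpen : IsOpen Ω
  nonempty : Ω.Nonempty
  convex : Convex ℝ Ω
  polytope : ∃ V : Finset (Pt d), closure Ω = convexHull ℝ (V : Set (Pt d))

/-- The vertex sets of the elements (triangles or tetrahedra) of a simplicial complex in `ℝᵈ`:
its faces with `d + 1` vertices. The element itself is the convex hull of the vertex set. -/
def elements {d : ℕ} (𝒯 : Geometry.SimplicialComplex ℝ (Pt d)) : Set (Finset (Pt d)) :=
  {s | s ∈ 𝒯.faces ∧ s.card = d + 1}

/-- `𝒯` is a (conforming) triangulation of `Ω`: a finite simplicial complex covering the closure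
of `Ω`, all of whose faces are faces of elements. -/
structure IsTriangulation {d : ℕ} (𝒯 : Geometry.SimplicialComplex ℝ (Pt d))
    (Ω : Set (Pt d)) : Prop where
  finite : 𝒯.faces.Finite
  space_eq : 𝒯.space = closure Ω
  pure : ∀ s ∈ 𝒯.faces, ∃ t ∈ elements 𝒯, s ⊆ t

/-- The Lagrange space `S_h^r`: continuous functions on the closure of `Ω` that are polynomials of
degree at most `r` on each element. As a normalization, such a function is regarded as a function
on all of `ℝᵈ` with the value `0` outside the closure of `Ω`; only values on `Ω` matter below. -/
def lagrangeSpace {d : ℕ} (Ω : Set (Pt d)) (𝒯 : Geometry.SimplicialComplex ℝ (Pt d)) (r : ℕ) :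
    Set (Pt d → ℝ) :=
  {v | ContinuousOn v (closure Ω) ∧
    (∀ s ∈ elements 𝒯, ∃ P : MvPolynomial (Fin d) ℝ, P.totalDegree ≤ r ∧
      ∀ x ∈ convexHull ℝ (s : Set (Pt d)), v x = MvPolynomial.eval (fun i => x i) P) ∧
    ∀ x, x ∉ closure Ω → v x = 0}

/-- The pressure space: functions in the Lagrange space of degree `k` with zero mean over `Ω`. -/
def pressureSpace {d : ℕ} (Ω : Set (Pt d)) (𝒯 : Geometry.SimplicialComplex ℝ (Pt d)) (k : ℕ) :
    Set (Pt d → ℝ) :=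
  {q | q ∈ lagrangeSpace Ω 𝒯 k ∧ ∫ x in Ω, q x = 0}

/-- The velocity space `X_h^r`: vector fields with components in the Lagrange space of degree `r`
that vanish on the boundary of `Ω` (for continuous piecewise polynomials, this is membership in
`H₀¹(Ω)ᵈ`). -/
def velocitySpace {d : ℕ} (Ω : Set (Pt d)) (𝒯 : Geometry.SimplicialComplex ℝ (Pt d)) (r : ℕ) :
    Set (Pt d → Pt d) :=
  {v | (∀ i, (fun x => v x i) ∈ lagrangeSpace Ω 𝒯 r) ∧ ∀ x ∈ frontier Ω, v x = 0}

/-! ### Inner products, norms and trilinear forms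

Finite element functions are smooth in the interior of each element, hence off a null set, and
their pointwise gradient is their weak gradient. -/

/-- The `L²(Ω)` inner product of real or vector valued functions. -/
noncomputable def l2 {d : ℕ} {F : Type*} [NormedAddCommGroup F] [InnerProductSpace ℝ F]
    (Ω : Set (Pt d)) (f g : Pt d → F) : ℝ :=
  ∫ x in Ω, inner ℝ (f x) (g x)

/-- The `L²(Ω)` inner product `(∇u, ∇v) = ∑ᵢ (∇uᵢ, ∇vᵢ)` of gradients of vector fields. -/
noncomputable def l2GradVec {d : ℕ} (Ω : Set (Pt d)) (u v : Pt d → Pt d) : ℝ :=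
  ∑ i, l2 Ω (gradient fun x => u x i) (gradient fun x => v x i)

/-- The `L²(Ω)` norm. -/
noncomputable def l2Norm {d : ℕ} {F : Type*} [NormedAddCommGroup F] [InnerProductSpace ℝ F]
    (Ω : Set (Pt d)) (f : Pt d → F) : ℝ :=
  Real.sqrt (l2 Ω f f)

/-- The `H¹(Ω)` norm of a scalar function. -/
noncomputable def h1Norm {d : ℕ} (Ω : Set (Pt d)) (f : Pt d → ℝ) : ℝ :=
  Real.sqrt (l2 Ω f f + l2 Ω (gradient f) (gradient f))

/-- The double well potential `F(s) = (s² - 1)² / (4 ε²)`. -/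
noncomputable def potential (ε s : ℝ) : ℝ := (s ^ 2 - 1) ^ 2 / (4 * ε ^ 2)

/-- The divergence of a vector field. -/
noncomputable def divergence {d : ℕ} (u : Pt d → Pt d) (x : Pt d) : ℝ :=
  ∑ i, gradient (fun y => u y i) x i

/-- The vector field `(u · ∇) v`, with components `u · ∇ vᵢ`. -/
noncomputable def convect {d : ℕ} (u v : Pt d → Pt d) (x : Pt d) : Pt d :=
  WithLp.toLp 2 fun i => inner ℝ (u x) (gradient (fun y => v y i) x)

/-- The trilinear form `b(φ, v, w) = (∇φ · v, w)`. -/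
noncomputable def bForm {d : ℕ} (Ω : Set (Pt d)) (φ : Pt d → ℝ) (v : Pt d → Pt d)
    (w : Pt d → ℝ) : ℝ :=
  l2 Ω (fun x => inner ℝ (gradient φ x) (v x)) w

/-- The trilinear form `B(u, v, w) = ½ ((u·∇)v, w) - ½ ((u·∇)w, v)`. -/
noncomputable def BForm {d : ℕ} (Ω : Set (Pt d)) (u v w : Pt d → Pt d) : ℝ :=
  1 / 2 * l2 Ω (convect u v) w - 1 / 2 * l2 Ω (convect u w) v

/-! ### The scheme -/

/-- The physical parameters: mobility `M`, mixing coefficient `lam`, viscosity `ν` and interfacial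
width `ε`, all positive. -/
structure Params where
  M : ℝ
  lam : ℝ
  ν : ℝ
  ε : ℝ
  M_pos : 0 < M
  lam_pos : 0 < lam
  ν_pos : 0 < ν
  ε_pos : 0 < ε

/-- A quadruple `(φ_h, μ_h, u_h, p_h)` at one time level. -/
structure Level (d : ℕ) where
  φ : Pt d → ℝ
  μ : Pt d → ℝ
  u : Pt d → Pt d
  p : Pt d → ℝ

/-- The quadruple lies in `S_h^r × S_h^r × X_h^r × (S_h^{r-1} ∩ L²₀)`. -/
structure Level.Mem {d : ℕ} (U : Level d) (Ω : Set (Pt d))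
    (𝒯 : Geometry.SimplicialComplex ℝ (Pt d)) (r : ℕ) : Prop where
  φ_mem : U.φ ∈ lagrangeSpace Ω 𝒯 r
  μ_mem : U.μ ∈ lagrangeSpace Ω 𝒯 r
  u_mem : U.u ∈ velocitySpace Ω 𝒯 r
  p_mem : U.p ∈ pressureSpace Ω 𝒯 (r - 1)

/-- `V` (level `n + 1`) together with the intermediate velocity `ut` solves the three steps of the
scheme with time step `τ`, starting from `U` (level `n`). The homogeneous Neumann conditions for
`φ` and `μ` are the natural boundary conditions of the first two (weak) equations; the homogeneous
boundary conditions for the velocities are part of the space `velocitySpace`. -/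
structure IsStep {d : ℕ} (c : Params) (Ω : Set (Pt d))
    (𝒯 : Geometry.SimplicialComplex ℝ (Pt d)) (r : ℕ) (τ : ℝ)
    (U : Level d) (ut : Pt d → Pt d) (V : Level d) : Prop where
  mem : V.Mem Ω 𝒯 r
  ut_mem : ut ∈ velocitySpace Ω 𝒯 r
  /-- Step 1, phase field equation. -/
  phase : ∀ w ∈ lagrangeSpace Ω 𝒯 r,
    l2 Ω (fun x => (V.φ x - U.φ x) / τ) w + bForm Ω V.φ U.u w
      + c.M * l2 Ω (gradient V.μ) (gradient w) = 0
  /-- Step 1, chemical potential. -/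
  chemical : ∀ ψ ∈ lagrangeSpace Ω 𝒯 r,
    l2 Ω V.μ ψ - c.lam * l2 Ω (gradient V.φ) (gradient ψ)
      - c.lam / c.ε ^ 2 * l2 Ω (fun x => V.φ x ^ 3 - U.φ x) ψ = 0
  /-- Step 2, intermediate velocity. -/
  momentum : ∀ v ∈ velocitySpace Ω 𝒯 r,
    l2 Ω (fun x => τ⁻¹ • (ut x - U.u x)) v + BForm Ω U.u ut v + c.ν * l2GradVec Ω ut v
      + l2 Ω (gradient U.p) v - bForm Ω V.φ v V.μ = 0
  /-- Step 3, projection (pressure correction). -/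
  projection : ∀ v ∈ velocitySpace Ω 𝒯 r,
    l2 Ω (fun x => τ⁻¹ • (V.u x - ut x)) v + l2 Ω (gradient fun x => V.p x - U.p x) v = 0
  /-- Step 3, discrete incompressibility. -/
  incompressible : ∀ q ∈ pressureSpace Ω 𝒯 (r - 1), l2 Ω (divergence V.u) q = 0

end CHNS

/-! One time step decouples: Step 1 involves only the new phase field and chemical potential, Step 2
is linear in the intermediate velocity, Step 3 is linear in the new velocity and pressure. So it
suffices to solve three finite dimensional problems in turn and to iterate.

Step 1 is nonlinear and is solved by a degree argument. A parameter `t` in [0, 1] multiplies the old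
phase field, the transport term and the nonlinearity. At `t = 0` the system is linear and injective.
For every `t`, take the deviations of `μ` and `φ` from their means as test functions in the first
and second equation, and eliminate the product of `μ` with the deviation of `φ`. The result controls
`‖∇φ‖²`, `‖∇μ‖²` and, through the cubic term, `t` times the fourth power of the deviation of `φ` in
`L²`. That quartic term absorbs the explicit transport term, whatever the size of `τ` and of the old
velocity. Testing with constants then bounds the means. The zeros stay in a fixed ball
(`exists_phaseResidual_bound`), so one exists at `t = 1` (`exists_zero_of_homotopy`). The bounds may
depend on the mesh, since norms on a finite dimensional space are equivalent.

The homotopy principle rests on the `C¹` no-retraction theorem, proved by the volume argument of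
Milnor and Rogers: for small `t` the map `x + t (f x - x)` permutes the unit ball, so the integral
of its Jacobian, a polynomial in `t`, is constant, yet it vanishes at `t = 1`.

Step 2 is a square system with a definite form, because the convection form is skew-symmetric
(`exists_eq_of_definite`). Step 3 is a saddle point problem; for existence alone no inf-sup
condition is needed (`exists_saddle_point`). Its two constraint forms match by integration by parts,
as velocities vanish on the boundary (`l2_divergence_eq_neg`). -/

namespace CHNS

open MeasureTheory Set Filter Topology

/-! ### Lipschitz bounds glued along finite closed covers -/

section Gluing

variable {E F : Type*} [NormedAddCommGroup E] [NormedSpace ℝ E] [NormedAddCommGroup F]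

/-- A continuous function on the line that is `K`-Lipschitz on each piece of a finite closed cover
of an interval satisfies the `K`-Lipschitz bound between the endpoints. -/
theorem norm_sub_le_of_finite_closed_cover {ι : Type*} [Finite ι] {f : ℝ → F} {K a b : ℝ}
    (hab : a ≤ b) (hf : ContinuousOn f (Icc a b)) (C : ι → Set ℝ) (hC : ∀ i, IsClosed (C i))
    (hcov : Icc a b ⊆ ⋃ i, C i)
    (hlip : ∀ i, ∀ x ∈ C i, ∀ y ∈ C i, ‖f x - f y‖ ≤ K * |x - y|) :
    ‖f b - f a‖ ≤ K * (b - a) := by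
  have hclosed : IsClosed ({x | ‖f x - f a‖ ≤ K * (x - a)} ∩ Icc a b) := by
    have h1 : ContinuousOn (fun x => K * (x - a) - ‖f x - f a‖) (Icc a b) := by fun_prop
    have h2 := h1.preimage_isClosed_of_isClosed isClosed_Icc (isClosed_Ici (a := (0 : ℝ)))
    convert h2 using 1
    ext x
    simp [and_comm]
  have key : Icc a b ⊆ {x | ‖f x - f a‖ ≤ K * (x - a)} := by
    refine hclosed.Icc_subset_of_forall_mem_nhdsWithin (by simp) ?_
    rintro x ⟨hx, hxab⟩
    -- Finitely many closed pieces miss `x`, so a neighbourhood of `x` meets only pieces that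
    -- contain `x`. A slightly larger `y` therefore shares a piece with `x`, and the bound
    -- propagates to the right.
    have h1 : ∀ᶠ y in 𝓝 x, ∀ i, y ∈ C i → x ∈ C i := by
      rw [eventually_all]
      intro i
      by_cases hxi : x ∈ C i
      · exact Eventually.of_forall fun _ _ => hxi
      · filter_upwards [(hC i).isOpen_compl.mem_nhds hxi] with y hy hy'
        exact absurd hy' hy
    have h2 : ∀ᶠ y in 𝓝[>] x, y < b :=
      mem_nhdsWithin_of_mem_nhds (Iio_mem_nhds hxab.2)
    filter_upwards [mem_nhdsWithin_of_mem_nhds h1, h2, self_mem_nhdsWithin] with y hy hyb hxy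
    rw [mem_Ioi] at hxy
    obtain ⟨i, hi⟩ := mem_iUnion.1 (hcov ⟨hxab.1.trans hxy.le, hyb.le⟩)
    have h3 := hlip i y hi x (hy i hi)
    rw [abs_of_pos (sub_pos.2 hxy)] at h3
    have h4 : ‖f x - f a‖ ≤ K * (x - a) := hx
    calc ‖f y - f a‖ = ‖(f y - f x) + (f x - f a)‖ := by rw [sub_add_sub_cancel]
      _ ≤ ‖f y - f x‖ + ‖f x - f a‖ := norm_add_le _ _
      _ ≤ K * (y - x) + K * (x - a) := by gcongr
      _ = K * (y - a) := by ring
  exact key ⟨hab, le_rfl⟩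

/-- A continuous function that is `K`-Lipschitz on each piece of a finite closed cover is
`K`-Lipschitz. -/
theorem lipschitzWith_of_finite_closed_cover {ι : Type*} [Finite ι] {f : E → F} {K : NNReal}
    (hf : Continuous f) (C : ι → Set E) (hC : ∀ i, IsClosed (C i)) (hcov : ⋃ i, C i = univ)
    (hlip : ∀ i, LipschitzOnWith K f (C i)) : LipschitzWith K f := by
  refine LipschitzWith.of_dist_le_mul fun x y => ?_
  set γ : ℝ → E := fun s => y + s • (x - y)
  have hγ : Continuous γ := by fun_prop
  have h := norm_sub_le_of_finite_closed_cover (f := f ∘ γ) (K := K * ‖x - y‖) zero_le_one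
    (hf.comp hγ).continuousOn (fun i => γ ⁻¹' C i) (fun i => (hC i).preimage hγ)
    (fun s _ => by rw [← preimage_iUnion, hcov]; trivial)
    (fun i s hs s' hs' => by
      have h1 := (hlip i).dist_le_mul _ hs _ hs'
      have h2 : γ s - γ s' = (s - s') • (x - y) := by simp only [γ, sub_smul]; abel
      rw [dist_eq_norm, dist_eq_norm, h2, norm_smul, Real.norm_eq_abs] at h1
      calc _ ≤ _ := h1
        _ = _ := by ring)
  simpa [γ, dist_eq_norm] using h

end Gluing

/-! ### The no-retraction theorem and zeros by homotopy -/

section NoRetraction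

variable {E : Type*} [NormedAddCommGroup E] [InnerProductSpace ℝ E] [FiniteDimensional ℝ E]

open Module in
/-- Lagrange interpolation of the polynomial `t ↦ det (1 + t A)` at `finrank + 1` nodes. -/
theorem det_one_add_eq_sum_lagrange {v : ℕ → ℝ} {s : Finset ℕ} (hv : InjOn v s)
    (hs : finrank ℝ E < s.card) (A : E →L[ℝ] E) :
    (1 + A).det = ∑ i ∈ s, (Lagrange.basis s v i).eval 1 * (1 + v i • A).det := by
  classical
  set b := Module.finBasis ℝ E
  set M := LinearMap.toMatrix b b (A : E →ₗ[ℝ] E)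
  -- The reversed characteristic polynomial of `-M` is `det (1 + X M)`, of degree at most the
  -- dimension.
  set p : Polynomial ℝ := (-M).charpolyRev
  have hp : ∀ t : ℝ, (1 + t • A).det = p.eval t := by
    intro t
    have h1 : (1 + t • A).det = (1 + t • M).det := by
      rw [ContinuousLinearMap.det, ← LinearMap.det_toMatrix b]
      congr 1
      ext i j
      simp [M, LinearMap.toMatrix_apply, Matrix.one_apply, Finsupp.single_apply, eq_comm]
    rw [h1]
    simp only [p, Matrix.charpolyRev]
    rw [← Polynomial.coe_evalRingHom, RingHom.map_det]
    congr 1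
    ext i j
    simp [Matrix.one_apply, apply_ite, mul_comm (M i j)]
  have hdeg : p.degree < s.card := by
    have : p.natDegree ≤ finrank ℝ E := by
      simp only [p]
      rw [← Matrix.reverse_charpoly]
      refine (Polynomial.reverse_natDegree_le _).trans ?_
      simp
    exact (Polynomial.degree_le_of_natDegree_le this).trans_lt (by exact_mod_cast hs)
  have h2 := Lagrange.eq_interpolate hv hdeg
  have h3 := hp 1
  rw [one_smul] at h3
  rw [h3, h2, Lagrange.interpolate_apply, Polynomial.eval_finsetSum]
  refine Finset.sum_congr rfl fun i _ => ?_
  rw [hp, Polynomial.eval_mul, Polynomial.eval_C, mul_comm]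

/-- The Jacobian of a differentiable bijection of `s` with positive Jacobian integrates to the
volume of `s`. -/
theorem integral_det_eq_volume_of_bijOn [MeasurableSpace E] [BorelSpace E] {f : E → E} {f' : E → E →L[ℝ] E} {s : Set E}
    (hs : MeasurableSet s) (hf : ∀ x ∈ s, HasFDerivAt f (f' x) x) (hbij : BijOn f s s)
    (hpos : ∀ x ∈ s, 0 < (f' x).det) : ∫ x in s, (f' x).det = (volume s).toReal := by
  have h := integral_image_eq_integral_abs_det_fderiv_smul volume hs
    (fun x hx => (hf x hx).hasFDerivWithinAt) hbij.injOn (fun _ => (1 : ℝ))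
  rw [hbij.image_eq] at h
  simp only [smul_eq_mul, mul_one, integral_const, MeasurableSet.univ, measureReal_restrict_apply,
    univ_inter] at h
  rw [← measureReal_def, h]
  exact setIntegral_congr_fun hs fun x hx => (abs_of_pos (hpos x hx)).symm

/-- A small perturbation `x + t (f x - x)` of the identity towards a retraction onto the unit
sphere is a bijection of the unit ball. -/
theorem bijOn_closedBall_of_small {f : E → E} (hnorm : ∀ x, ‖f x‖ = 1) {g : E → E}
    (hg : ∀ x, ‖x‖ ≤ 1 → g x = f x - x) (hg' : ∀ x, 1 < ‖x‖ → g x = 0) {K : NNReal}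
    (hK : LipschitzWith K g) {t : ℝ} (ht0 : 0 ≤ t) (ht1 : t ≤ 1) (htK : t * K < 1) :
    BijOn (fun x => x + t • (f x - x)) (Metric.closedBall 0 1) (Metric.closedBall 0 1) := by
  have := FiniteDimensional.complete ℝ E
  -- Solving `x + t g(x) = y` is a fixed point problem for a contraction of the whole space; this is
  -- why `g` is extended by zero outside the ball. A fixed point outside the ball would equal `y`,
  -- which lies inside.
  have hcontr : ∀ y : E, ContractingWith (t.toNNReal * K) (fun x => y - t • g x) := by
    intro y
    refine ⟨?_, ?_⟩
    · rw [← NNReal.coe_lt_coe]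
      simpa [ht0] using htK
    · refine LipschitzWith.of_dist_le_mul fun a b => ?_
      have h1 := hK.dist_le_mul b a
      rw [dist_eq_norm, dist_comm b a] at h1
      rw [dist_eq_norm, show y - t • g a - (y - t • g b) = t • (g b - g a) by
        rw [smul_sub]; abel, norm_smul, Real.norm_of_nonneg ht0, NNReal.coe_mul,
        Real.coe_toNNReal _ ht0, mul_assoc]
      exact mul_le_mul_of_nonneg_left h1 ht0
  refine ⟨?_, ?_, ?_⟩
  · intro x hx
    have hx' : ‖x‖ ≤ 1 := by simpa using hx
    have h1 : x + t • (f x - x) = (1 - t) • x + t • f x := by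
      rw [smul_sub, sub_smul, one_smul]; abel
    simp only [mem_closedBall_zero_iff, h1]
    calc _ ≤ ‖(1 - t) • x‖ + ‖t • f x‖ := norm_add_le _ _
      _ = (1 - t) * ‖x‖ + t := by
        rw [norm_smul, norm_smul, hnorm, Real.norm_of_nonneg ht0,
          Real.norm_of_nonneg (sub_nonneg.2 ht1), mul_one]
      _ ≤ (1 - t) * 1 + t := by gcongr
      _ = 1 := by ring
  · intro x hx y hy hxy
    have hx' : ‖x‖ ≤ 1 := by simpa using hx
    have hy' : ‖y‖ ≤ 1 := by simpa using hy
    simp only [← hg x hx', ← hg y hy'] at hxy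
    refine (hcontr (x + t • g x)).fixedPoint_unique' ?_ ?_
    · simp [Function.IsFixedPt]
    · simp [Function.IsFixedPt, hxy]
  · intro y hy
    have hy' : ‖y‖ ≤ 1 := by simpa using hy
    obtain ⟨x, hx⟩ : ∃ x, y - t • g x = x := ⟨_, (hcontr y).fixedPoint_isFixedPt⟩
    have hxb : ‖x‖ ≤ 1 := by
      by_contra! h
      rw [hg' x h, smul_zero, sub_zero] at hx
      rw [hx] at hy'
      exact absurd h hy'.not_gt
    refine ⟨x, by simpa using hxb, ?_⟩
    simp only [← hg x hxb]
    nth_rewrite 1 [← hx]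
    abel

/-- There is no `C¹` map into the unit sphere that is the identity on the unit sphere. -/
theorem not_exists_contDiff_retraction [MeasurableSpace E] [BorelSpace E] {f : E → E} (hf : ContDiff ℝ 1 f) (hnorm : ∀ x, ‖f x‖ = 1)
    (hid : ∀ x, ‖x‖ = 1 → f x = x) : False := by
  classical
  set B : Set E := Metric.closedBall 0 1
  have hBc : IsCompact B := isCompact_closedBall 0 1
  set g : E → E := fun x => if ‖x‖ ≤ 1 then f x - x else 0
  have hgc : Continuous g := by
    refine Continuous.if_le (hf.continuous.sub continuous_id) continuous_const continuous_norm
      continuous_const fun x hx => ?_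
    rw [hid x hx, sub_self]
  obtain ⟨K, hK⟩ : ∃ K, LipschitzOnWith K (fun x => f x - x) B :=
    (hf.sub contDiff_id).contDiffOn.exists_lipschitzOnWith one_ne_zero (convex_closedBall 0 1) hBc
  have hgK : LipschitzWith K g := by
    refine lipschitzWith_of_finite_closed_cover hgc
      (fun i : Bool => if i then B else {x | 1 ≤ ‖x‖}) ?_ ?_ ?_
    · rintro (_ | _)
      · simpa using isClosed_le continuous_const continuous_norm
      · simpa using Metric.isClosed_closedBall
    · ext x
      have := le_total ‖x‖ 1
      simpa [B, or_comm] using this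
    · rintro (_ | _)
      · intro x hx y hy
        have h0 : ∀ z : E, 1 ≤ ‖z‖ → g z = 0 := by
          intro z hz
          by_cases h : ‖z‖ ≤ 1
          · simp [g, h, hid z (le_antisymm h hz)]
          · simp [g, h]
        simp [h0 x (by simpa using hx), h0 y (by simpa using hy)]
      · intro x hx y hy
        have hx' : ‖x‖ ≤ 1 := by simpa [B] using hx
        have hy' : ‖y‖ ≤ 1 := by simpa [B] using hy
        simpa [g, hx', hy'] using hK (by simpa using hx) (by simpa using hy)
  have hcd : Continuous fun x => fderiv ℝ f x := hf.continuous_fderiv one_ne_zero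
  have hcdet : Continuous fun p : ℝ × E => (1 + p.1 • (fderiv ℝ f p.2 - 1)).det :=
    ContinuousLinearMap.continuous_det.comp (by fun_prop)
  have hev : ∀ᶠ t : ℝ in 𝓝 0, ∀ x ∈ B, 0 < (1 + t • (fderiv ℝ f x - 1)).det := by
    refine hBc.eventually_forall_of_forall_eventually fun x _ => ?_
    have : Tendsto (fun p : ℝ × E => (1 + p.1 • (fderiv ℝ f p.2 - 1)).det) (𝓝 (0, x)) (𝓝 1) := by
      have h := hcdet.tendsto (0, x)
      simpa [ContinuousLinearMap.det] using h
    exact this.eventually (lt_mem_nhds one_pos)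
  have hev2 : ∀ᶠ t : ℝ in 𝓝 0, t * K < 1 := by
    have : Tendsto (fun t : ℝ => t * K) (𝓝 0) (𝓝 0) := by
      exact (continuous_id.mul (continuous_const (y := (K : ℝ)))).tendsto' 0 0 (by simp)
    exact this.eventually (gt_mem_nhds one_pos)
  obtain ⟨δ, hδ, hsmall⟩ := Metric.eventually_nhds_iff.1
    ((hev.and hev2).and (gt_mem_nhds one_pos))
  have hvol : ∀ t : ℝ, 0 < t → t < δ →
      ∫ x in B, (1 + t • (fderiv ℝ f x - 1)).det = (volume B).toReal := by
    intro t ht htδ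
    obtain ⟨⟨h1, h2⟩, h3⟩ := hsmall (y := t) (by simpa [abs_of_pos ht] using htδ)
    refine integral_det_eq_volume_of_bijOn (f := fun x => x + t • (f x - x))
      Metric.isClosed_closedBall.measurableSet (fun x _ => ?_)
      (bijOn_closedBall_of_small hnorm (g := g) (fun x hx => by simp [g, hx])
        (fun x hx => by simp [g, hx]) hgK ht.le h3.le h2) h1
    exact (hasFDerivAt_id x).add
      ((((hf.differentiable one_ne_zero) x).hasFDerivAt.sub (hasFDerivAt_id x)).const_smul t)
  set n := Module.finrank ℝ E
  -- Distinct interpolation nodes in `(0, δ)`, where the Jacobian integral is known; one more than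
  -- the degree requires for recovery of the value at `1`.
  set v : ℕ → ℝ := fun i => δ / (i + 2)
  have hvinj : InjOn v (Finset.range (n + 1)) := by
    intro i _ j _ hij
    simp only [v] at hij
    have h1 : (i : ℝ) + 2 ≠ 0 := by positivity
    have h2 : (j : ℝ) + 2 ≠ 0 := by positivity
    rw [div_eq_div_iff h1 h2] at hij
    have h3 := mul_left_cancel₀ hδ.ne' hij
    have h4 : (i : ℝ) = j := by linarith
    exact_mod_cast h4
  have hv : ∀ i, 0 < v i ∧ v i < δ := by
    intro i
    refine ⟨by positivity, div_lt_self hδ ?_⟩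
    have : (0 : ℝ) ≤ i := Nat.cast_nonneg i
    linarith
  -- Differentiating `‖f‖² = 1` shows that the range of the derivative at `x` is orthogonal to `f x
  -- ≠ 0`, so the derivative is singular.
  have hdet0 : ∀ x, (1 + (fderiv ℝ f x - 1)).det = 0 := by
    intro x
    rw [add_sub_cancel]
    by_contra hne
    have hsurj : Function.Surjective (fderiv ℝ f x) := by
      have := ((fderiv ℝ f x : E →ₗ[ℝ] E).equivOfDetNeZero hne).surjective
      exact this
    obtain ⟨w, hw⟩ := hsurj (f x)
    have hd := ((hf.differentiable one_ne_zero) x).hasFDerivAt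
    have h1 := hd.norm_sq
    have h2 : (fun y => ‖f y‖ ^ 2) = fun _ => (1 : ℝ) := by
      ext y; simp [hnorm]
    rw [h2] at h1
    have h3 := h1.unique (hasFDerivAt_const (1 : ℝ) x)
    have h4 := congrArg (fun L : E →L[ℝ] ℝ => L w) h3
    simp [hw, hnorm] at h4
  -- Integrate the interpolation identity at `1`. Every node contributes the same volume and the
  -- basis polynomials sum to `1`, so the volume of the ball would be zero.
  have hsum : (0 : ℝ) = ∑ i ∈ Finset.range (n + 1),
      (Lagrange.basis (Finset.range (n + 1)) v i).eval 1 * (volume B).toReal := by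
    calc (0 : ℝ) = ∫ x in B, (1 + (fderiv ℝ f x - 1)).det := by simp only [hdet0, integral_zero]
      _ = ∫ x in B, ∑ i ∈ Finset.range (n + 1),
          (Lagrange.basis (Finset.range (n + 1)) v i).eval 1 *
            (1 + v i • (fderiv ℝ f x - 1)).det := by
        refine integral_congr_ae (Eventually.of_forall fun x => ?_)
        exact det_one_add_eq_sum_lagrange hvinj (by simp [n]) _
      _ = _ := by
        rw [integral_finsetSum]
        · refine Finset.sum_congr rfl fun i _ => ?_
          rw [integral_const_mul, hvol _ (hv i).1 (hv i).2]
        · intro i _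
          have hc : Continuous fun x => (1 + v i • (fderiv ℝ f x - 1)).det :=
            hcdet.comp (by fun_prop : Continuous fun x : E => (v i, x))
          exact (hc.continuousOn.integrableOn_compact hBc).const_mul _
  rw [← Finset.sum_mul, ← Polynomial.eval_finsetSum, Lagrange.sum_basis hvinj (by simp)] at hsum
  have hB : 0 < (volume B).toReal :=
    ENNReal.toReal_pos (Metric.measure_closedBall_pos volume 0 one_pos).ne' hBc.measure_lt_top.ne
  simp at hsum
  linarith [hsum]

/-- A `C¹` homotopy starting at the identity, without zeros far away, ends at a map with a
zero. -/
theorem exists_zero_of_homotopy_id {k : ℝ → E → E}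
    (hk : ContDiff ℝ 1 fun p : ℝ × E => k p.1 p.2) (hk0 : ∀ x, k 0 x = x) {R : ℝ}
    (hR : ∀ t ∈ Icc (0 : ℝ) 1, ∀ x, R ≤ ‖x‖ → k t x ≠ 0) : ∃ x, k 1 x = 0 := by
  by_contra! hne
  borelize E
  set r : ℝ := max R 1
  have hr : 0 < r := one_pos.trans_le (le_max_right _ _)
  let χ : ContDiffBump (0 : E) := ⟨r, 2 * r, hr, by linarith⟩
  -- A cutoff in the homotopy parameter: `G` is the final map on the ball of radius `r` and the
  -- identity beyond `2 r`. It has no zero, so rescaling and normalizing it gives a forbidden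
  -- retraction.
  set G : E → E := fun x => k (χ x) x
  have hG : ContDiff ℝ 1 G := hk.comp (χ.contDiff.prodMk contDiff_id)
  have hG0 : ∀ x, G x ≠ 0 := by
    intro x
    rcases le_total ‖x‖ r with h | h
    · have : χ x = 1 := χ.one_of_mem_closedBall (by simpa [χ] using h)
      simpa [G, this] using hne x
    · exact hR _ ⟨χ.nonneg, χ.le_one⟩ x ((le_max_left _ _).trans h)
  have hGid : ∀ x, 2 * r ≤ ‖x‖ → G x = x := by
    intro x hx
    have : χ x = 0 := χ.zero_of_le_dist (by simpa [χ] using hx)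
    simp [G, this, hk0]
  have hGs : ContDiff ℝ 1 fun x => G ((2 * r) • x) := hG.comp (contDiff_id.const_smul _)
  refine not_exists_contDiff_retraction (f := fun x => ‖G ((2 * r) • x)‖⁻¹ • G ((2 * r) • x))
    (((hGs.norm ℝ fun x => hG0 _).inv fun x => norm_ne_zero_iff.2 (hG0 _)).smul hGs) ?_ ?_
  · intro x
    rw [norm_smul, norm_inv, norm_norm, inv_mul_cancel₀ (norm_ne_zero_iff.2 (hG0 _))]
  · intro x hx
    have h1 : ‖(2 * r) • x‖ = 2 * r := by
      rw [norm_smul, hx, mul_one, Real.norm_of_nonneg (by positivity)]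
    simp only [hGid _ h1.ge, h1]
    rw [smul_smul, inv_mul_cancel₀ (by positivity), one_smul]

end NoRetraction

/-- A `C¹` homotopy starting at a linear isomorphism of finite dimensional spaces, without zeros
far away, ends at a map with a zero. -/
theorem exists_zero_of_homotopy {E F : Type*} [NormedAddCommGroup E] [NormedSpace ℝ E]
    [FiniteDimensional ℝ E] [NormedAddCommGroup F] [NormedSpace ℝ F] (L : E ≃L[ℝ] F)
    {h : ℝ → E → F} (hh : ContDiff ℝ 1 fun p : ℝ × E => h p.1 p.2) (h0 : ∀ x, h 0 x = L x)
    {R : ℝ} (hR : ∀ t ∈ Icc (0 : ℝ) 1, ∀ x, h t x = 0 → ‖x‖ ≤ R) : ∃ x, h 1 x = 0 := by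
  set e : E ≃L[ℝ] EuclideanSpace ℝ (Fin (Module.finrank ℝ E)) := toEuclidean
  set A : E →L[ℝ] EuclideanSpace ℝ (Fin (Module.finrank ℝ E)) := e.toContinuousLinearMap
  obtain ⟨y, hy⟩ := exists_zero_of_homotopy_id (k := fun t y => e (L.symm (h t (e.symm y))))
    (R := ‖A‖ * R + 1)
    (e.contDiff.comp (L.symm.contDiff.comp (hh.comp
      (contDiff_fst.prodMk (e.symm.contDiff.comp contDiff_snd)))))
    (fun x => by simp [h0]) (fun t ht y hy hz => by
      have hz' : h t (e.symm y) = 0 := by simpa using hz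
      have h1 := hR t ht _ hz'
      have h2 : ‖y‖ ≤ ‖A‖ * ‖e.symm y‖ := by
        simpa [A] using A.le_opNorm (e.symm y)
      have h3 := mul_le_mul_of_nonneg_left h1 (norm_nonneg A)
      linarith)
  exact ⟨e.symm y, by simpa using hy⟩

end CHNS

namespace CHNS

open MeasureTheory Set Filter Topology

/-! ### The abstract Cahn–Hilliard step -/

section PhaseField

variable {V H K : Type*} [NormedAddCommGroup V] [NormedSpace ℝ V] [FiniteDimensional ℝ V]
  [NormedAddCommGroup H] [InnerProductSpace ℝ H] [NormedAddCommGroup K] [InnerProductSpace ℝ K]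

/-- Young's inequality moves the `m` terms into half of `M m²` and leaves multiples of `a²`, which
the quartic term absorbs. All terms in `a` carry the same factor `t`, so the bound does not depend
on `t`. -/
theorem quadratic_bound_of_quartic {A B M c₁ c₂ c₃ x m a t : ℝ} (hB : 0 < B) (hM : 0 < M)
    (ht0 : 0 ≤ t) (ht1 : t ≤ 1)
    (h : A * x ^ 2 + t * (B * a ^ 4) + M * m ^ 2 ≤ t * (c₁ * a) + t * (c₂ * m) + t * (c₃ * (a * m))) :
    A * x ^ 2 + M / 2 * m ^ 2 ≤
      c₂ ^ 2 / M + c₁ ^ 2 / 2 + (1 / 2 + c₃ ^ 2 / M) ^ 2 / (4 * B) := by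
  set q := 1 / 2 + c₃ ^ 2 / M
  have h1 : c₂ * m ≤ M / 4 * m ^ 2 + c₂ ^ 2 / M := by
    have : M / 4 * m ^ 2 + c₂ ^ 2 / M - c₂ * m = (M * m / 2 - c₂) ^ 2 / M := by
      field_simp; ring
    have h2 : 0 ≤ (M * m / 2 - c₂) ^ 2 / M := by positivity
    linarith
  have h2 : c₃ * (a * m) ≤ M / 4 * m ^ 2 + c₃ ^ 2 / M * a ^ 2 := by
    have : M / 4 * m ^ 2 + c₃ ^ 2 / M * a ^ 2 - c₃ * (a * m) = (M * m / 2 - c₃ * a) ^ 2 / M := by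
      field_simp; ring
    have h2 : 0 ≤ (M * m / 2 - c₃ * a) ^ 2 / M := by positivity
    linarith
  have h3 : c₁ * a ≤ c₁ ^ 2 / 2 + 1 / 2 * a ^ 2 := by nlinarith [sq_nonneg (c₁ - a)]
  have h4 : q * a ^ 2 ≤ B * a ^ 4 + q ^ 2 / (4 * B) := by
    have : B * a ^ 4 + q ^ 2 / (4 * B) - q * a ^ 2 = (2 * B * a ^ 2 - q) ^ 2 / (4 * B) := by
      field_simp; ring
    have h2 : 0 ≤ (2 * B * a ^ 2 - q) ^ 2 / (4 * B) := by positivity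
    linarith
  have h5 : c₁ * a + c₂ * m + c₃ * (a * m) - B * a ^ 4 ≤
      M / 2 * m ^ 2 + (c₂ ^ 2 / M + c₁ ^ 2 / 2 + q ^ 2 / (4 * B)) := by
    have : q * a ^ 2 = 1 / 2 * a ^ 2 + c₃ ^ 2 / M * a ^ 2 := by ring
    linarith
  have h6 : 0 ≤ M / 2 * m ^ 2 + (c₂ ^ 2 / M + c₁ ^ 2 / 2 + q ^ 2 / (4 * B)) := by positivity
  have h7 := mul_le_mul_of_nonneg_left h5 ht0
  have h8 := mul_le_mul_of_nonneg_right ht1 h6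
  linarith

/-- The residual of the phase field equations with a homotopy parameter `t`, as a functional of
the test functions. -/
noncomputable def phaseResidual (ι : V →L[ℝ] H) (G : V →L[ℝ] K) (D : V →L[ℝ] H) (N : V → H)
    (f : H) (τ M lam γ t : ℝ) (x : V × V) : V × V →L[ℝ] ℝ :=
  (innerSL ℝ (τ⁻¹ • (ι x.1 - t • f) + t • D x.1)) ∘L ι ∘L ContinuousLinearMap.fst ℝ V V
    + (innerSL ℝ (M • G x.2)) ∘L G ∘L ContinuousLinearMap.fst ℝ V V
    + (innerSL ℝ (ι x.2 - (t * γ) • (N x.1 - f))) ∘L ι ∘L ContinuousLinearMap.snd ℝ V V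
    - (innerSL ℝ (lam • G x.1)) ∘L G ∘L ContinuousLinearMap.snd ℝ V V

variable {ι : V →L[ℝ] H} {G : V →L[ℝ] K} {D : V →L[ℝ] H} {N : V → H} {f : H} {one : V}
  {τ M lam γ κ t : ℝ}

omit [FiniteDimensional ℝ V] in
theorem phaseResidual_apply (x y : V × V) :
    phaseResidual ι G D N f τ M lam γ t x y =
      inner ℝ (τ⁻¹ • (ι x.1 - t • f) + t • D x.1) (ι y.1) + M * inner ℝ (G x.2) (G y.1)
      + inner ℝ (ι x.2 - (t * γ) • (N x.1 - f)) (ι y.2) - lam * inner ℝ (G x.1) (G y.2) := by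
  simp [phaseResidual, inner_sub_left, inner_add_left, inner_smul_left]

theorem contDiff_phaseResidual (hN : ContDiff ℝ 1 N) :
    ContDiff ℝ 1 fun p : ℝ × (V × V) => phaseResidual ι G D N f τ M lam γ p.1 p.2 := by
  rw [contDiff_clm_apply_iff]
  intro y
  simp only [phaseResidual_apply]
  have hN' : ContDiff ℝ 1 fun p : ℝ × (V × V) => N p.2.1 := hN.comp (by fun_prop)
  have h1 : ContDiff ℝ 1 fun p : ℝ × (V × V) =>
      τ⁻¹ • (ι p.2.1 - p.1 • f) + p.1 • D p.2.1 := by fun_prop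
  have h2 : ContDiff ℝ 1 fun p : ℝ × (V × V) =>
      ι p.2.2 - (p.1 * γ) • (N p.2.1 - f) := by fun_prop
  have h3 : ContDiff ℝ 1 fun p : ℝ × (V × V) => G p.2.1 := by fun_prop
  have h4 : ContDiff ℝ 1 fun p : ℝ × (V × V) => G p.2.2 := by fun_prop
  exact (((h1.inner ℝ contDiff_const).add (contDiff_const.mul (h4.inner ℝ contDiff_const))).add
    (h2.inner ℝ contDiff_const)).sub (contDiff_const.mul (h3.inner ℝ contDiff_const))

-- Testing with the pair swapped makes the mixed products cancel and leaves a sum of nonnegative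
-- gradient terms; both gradients vanish, and then testing each component with itself kills it.
omit [FiniteDimensional ℝ V] in
theorem phaseResidual_zero_eq_zero (hι : Function.Injective ι)
    (hτ : 0 < τ) (hM : 0 < M) (hlam : 0 < lam) {x : V × V}
    (hx : phaseResidual ι G D N f τ M lam γ 0 x = 0) : x = 0 := by
  have key : ∀ y : V × V, τ⁻¹ * inner ℝ (ι x.1) (ι y.1) + M * inner ℝ (G x.2) (G y.1)
      + inner ℝ (ι x.2) (ι y.2) - lam * inner ℝ (G x.1) (G y.2) = 0 := by
    intro y
    have := congrArg (fun L => L y) hx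
    simpa [phaseResidual_apply, inner_smul_left] using this
  have h1 := key (x.2, 0)
  have h2 := key (0, x.1)
  simp only [map_zero, inner_zero_right, mul_zero, add_zero, sub_zero, zero_add,
    real_inner_self_eq_norm_sq] at h1 h2
  rw [real_inner_comm] at h2
  have h3 : inner ℝ (ι x.1) (ι x.2) = lam * ‖G x.1‖ ^ 2 := by linarith
  rw [h3] at h1
  have hτ' : 0 < τ⁻¹ := inv_pos.2 hτ
  have h4 : 0 ≤ τ⁻¹ * (lam * ‖G x.1‖ ^ 2) := by positivity
  have h5 : 0 ≤ M * ‖G x.2‖ ^ 2 := by positivity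
  have h6 : G x.1 = 0 := by
    have : τ⁻¹ * (lam * ‖G x.1‖ ^ 2) = 0 := by linarith
    simpa [hτ'.ne', hlam.ne', hτ.ne'] using this
  have h7 : G x.2 = 0 := by
    have : M * ‖G x.2‖ ^ 2 = 0 := by linarith
    simpa [hM.ne'] using this
  have h8 := key (x.1, 0)
  have h9 := key (0, x.2)
  simp [h6, h7, hτ.ne'] at h8 h9
  exact Prod.ext ((map_eq_zero_iff ι hι).1 h8) ((map_eq_zero_iff ι hι).1 h9)

open Module in
/-- For `t = 0` the residual is a linear isomorphism. -/
theorem exists_phaseResidual_zero_equiv (hι : Function.Injective ι)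
    (hτ : 0 < τ) (hM : 0 < M) (hlam : 0 < lam) :
    ∃ L : (V × V) ≃L[ℝ] (V × V →L[ℝ] ℝ), ∀ x, phaseResidual ι G D N f τ M lam γ 0 x = L x := by
  let T : V × V →ₗ[ℝ] (V × V →L[ℝ] ℝ) :=
    { toFun := phaseResidual ι G D N f τ M lam γ 0
      map_add' := fun x y => by
        ext z <;> simp [phaseResidual_apply, inner_add_left, inner_smul_left] <;> ring
      map_smul' := fun c x => by
        ext z <;> simp [phaseResidual_apply, inner_smul_left] <;> ring }
  have hT : Function.Injective T := by
    rw [← LinearMap.ker_eq_bot, LinearMap.ker_eq_bot']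
    exact fun x hx => phaseResidual_zero_eq_zero hι hτ hM hlam hx
  have hdim : finrank ℝ (V × V) = finrank ℝ (V × V →L[ℝ] ℝ) := by
    rw [← (LinearMap.toContinuousLinearMap (𝕜 := ℝ) (E := V × V) (F' := ℝ)).finrank_eq]
    exact (Subspace.dual_finrank_eq (K := ℝ) (V := V × V)).symm
  exact ⟨(LinearEquiv.ofInjectiveOfFinrankEq T hT hdim).toContinuousLinearEquiv, fun x => rfl⟩

/-- Poincaré type inequality in finite dimension. -/
theorem exists_poincare (hι : Function.Injective ι) (hG : ∀ v, G v = 0 → ∃ c : ℝ, v = c • one) :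
    ∃ C : ℝ, 0 ≤ C ∧ ∀ v, ‖v‖ ≤ C * (‖G v‖ + |inner ℝ (ι v) (ι one)|) := by
  -- Gradient and mean together determine `v`, and an injective linear map on a finite dimensional
  -- space is bounded below.
  let T : V →ₗ[ℝ] K × ℝ := (G : V →ₗ[ℝ] K).prod ((innerₗ H (ι one)) ∘ₗ (ι : V →ₗ[ℝ] H))
  have hT : LinearMap.ker T = ⊥ := by
    rw [LinearMap.ker_eq_bot']
    intro v hv
    have hv1 : G v = 0 := congrArg Prod.fst hv
    have hv2 : inner ℝ (ι one) (ι v) = 0 := congrArg Prod.snd hv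
    obtain ⟨c, rfl⟩ := hG v hv1
    have : ι (c • one) = 0 := by
      rw [← inner_self_eq_zero (𝕜 := ℝ)]
      nth_rewrite 1 [map_smul]
      rw [inner_smul_left, hv2, mul_zero]
    exact (map_eq_zero_iff ι hι).1 this
  obtain ⟨C, -, hC⟩ := T.exists_antilipschitzWith hT
  refine ⟨C, C.2, fun v => ?_⟩
  have h := hC.le_mul_dist v 0
  rw [map_zero, dist_zero_right, dist_zero_right] at h
  refine h.trans (mul_le_mul_of_nonneg_left ?_ C.2)
  simp only [T, Prod.norm_def]
  refine max_le (le_add_of_nonneg_right (abs_nonneg _)) ?_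
  simp [real_inner_comm]

/-- A priori bound for the zeros of the residual, uniform in the homotopy parameter. -/
theorem exists_phaseResidual_bound (hι : Function.Injective ι)
    (hG : ∀ v, G v = 0 → ∃ c : ℝ, v = c • one) (hG1 : G one = 0) (hone : one ≠ 0)
    (hD1 : D one = 0) (hN : Continuous N) (hκ : 0 < κ)
    (hNc : ∀ v, ∀ c : ℝ, inner ℝ (ι (v - c • one)) (ι one) = 0 →
      κ * ‖ι (v - c • one)‖ ^ 4 ≤ inner ℝ (N v) (ι (v - c • one)))
    (hτ : 0 < τ) (hM : 0 < M) (hlam : 0 < lam) (hγ : 0 < γ) :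
    ∃ R : ℝ, ∀ t ∈ Icc (0 : ℝ) 1, ∀ x, phaseResidual ι G D N f τ M lam γ t x = 0 → ‖x‖ ≤ R := by
  obtain ⟨C, hC0, hC⟩ := exists_poincare hι hG
  obtain ⟨C₁, -, hC₁⟩ := (ι : V →ₗ[ℝ] H).exists_antilipschitzWith (LinearMap.ker_eq_bot.2 hι)
  replace hC₁ : ∀ v, ‖v‖ ≤ C₁ * ‖ι v‖ := fun v => by
    simpa [dist_zero_right] using hC₁.le_mul_dist v 0
  have hs : inner ℝ (ι one) (ι one) ≠ 0 := by
    rw [Ne, inner_self_eq_zero (𝕜 := ℝ), map_eq_zero_iff ι hι]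
    exact hone
  set m₀ : V → ℝ := fun v => inner ℝ (ι v) (ι one) / inner ℝ (ι one) (ι one)
  have horth : ∀ v, inner ℝ (ι (v - m₀ v • one)) (ι one) = 0 := by
    intro v
    rw [map_sub, map_smul, inner_sub_left, real_inner_smul_left, div_mul_cancel₀ _ hs, sub_self]
  have hGm : ∀ v, G (v - m₀ v • one) = G v := fun v => by simp [hG1]
  have hDm : ∀ v, D (v - m₀ v • one) = D v := fun v => by simp [hD1]
  have hP : ∀ v, ‖v - m₀ v • one‖ ≤ C * ‖G v‖ := fun v => by
    simpa only [hGm, horth, abs_zero, add_zero] using hC (v - m₀ v • one)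
  have hιP : ∀ v, ‖ι (v - m₀ v • one)‖ ≤ ‖ι‖ * (C * ‖G v‖) := fun v =>
    (ι.le_opNorm _).trans (mul_le_mul_of_nonneg_left (hP v) (norm_nonneg _))
  -- Both sides are the covariance of `v` and `w`.
  have hsymm : ∀ v w, inner ℝ (ι v) (ι (w - m₀ w • one)) = inner ℝ (ι w) (ι (v - m₀ v • one)) := by
    intro v w
    have h1 : ∀ a b, inner ℝ (ι a) (ι (b - m₀ b • one)) =
        inner ℝ (ι (a - m₀ a • one)) (ι (b - m₀ b • one)) := by
      intro a b
      rw [map_sub ι a, inner_sub_left, map_smul, real_inner_smul_left,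
        real_inner_comm (ι (b - m₀ b • one)) (ι one), horth b, mul_zero, sub_zero]
    rw [h1 v w, h1 w v, real_inner_comm]
  -- These are the coefficients of the tested equations: with `a` the norm of the deviation of `φ`
  -- and `m = ‖G μ‖`, they give `A ‖G φ‖² + t B a⁴ + M m² ≤ t (c₁ a + c₂ m + c₃ a m)`. The factor
  -- `C₁` in `c₃` is an inverse inequality; the transport term sees only the deviation because `D
  -- one = 0`.
  set A := lam / τ
  set B := γ * κ / τ
  set c₁ := γ * ‖f‖ / τ
  set c₂ := ‖f‖ * (‖ι‖ * C) / τ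
  set c₃ := ‖D‖ * C₁ * (‖ι‖ * C)
  set Q := c₂ ^ 2 / M + c₁ ^ 2 / 2 + (1 / 2 + c₃ ^ 2 / M) ^ 2 / (4 * B)
  have hA : 0 < A := div_pos hlam hτ
  have hB : 0 < B := div_pos (mul_pos hγ hκ) hτ
  set g₁ := Real.sqrt (Q / A)
  set g₂ := Real.sqrt (Q / (M / 2))
  set R₁ := C * (g₁ + (‖f‖ * ‖ι one‖ + τ * (‖D‖ * (C * g₁) * ‖ι one‖)))
  -- The mean of `μ` is governed by `N φ`, so `φ` has to be bounded before `μ`.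
  obtain ⟨Q₂, hQ₂⟩ := (isCompact_closedBall (0 : V) R₁).exists_bound_of_continuousOn
    hN.continuousOn
  refine ⟨max R₁ (C * (g₂ + γ * ((Q₂ + ‖f‖) * ‖ι one‖))), ?_⟩
  rintro t ⟨ht0, ht1⟩ ⟨φ, μ⟩ hx
  have key : ∀ w ψ, inner ℝ (τ⁻¹ • (ι φ - t • f) + t • D φ) (ι w) + M * inner ℝ (G μ) (G w)
      + inner ℝ (ι μ - (t * γ) • (N φ - f)) (ι ψ) - lam * inner ℝ (G φ) (G ψ) = 0 := by
    intro w ψ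
    rw [← phaseResidual_apply (φ, μ) (w, ψ), hx]
    rfl
  have hmain : A * ‖G φ‖ ^ 2 + M / 2 * ‖G μ‖ ^ 2 ≤ Q := by
    refine quadratic_bound_of_quartic (a := ‖ι (φ - m₀ φ • one)‖) hB hM ht0 ht1 ?_
    have e1 := key (μ - m₀ μ • one) 0
    have e2 := key 0 (φ - m₀ φ • one)
    simp only [map_zero, inner_zero_right, mul_zero, add_zero, sub_zero, zero_add, hGm,
      real_inner_self_eq_norm_sq, inner_add_left, inner_sub_left, real_inner_smul_left] at e1 e2
    rw [hsymm φ μ] at e1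
    have i1 := hNc φ (m₀ φ) (horth φ)
    have i2 : inner ℝ f (ι (φ - m₀ φ • one)) ≤ ‖f‖ * ‖ι (φ - m₀ φ • one)‖ :=
      real_inner_le_norm _ _
    have i3 : inner ℝ f (ι (μ - m₀ μ • one)) ≤ ‖f‖ * (‖ι‖ * (C * ‖G μ‖)) :=
      (real_inner_le_norm _ _).trans (mul_le_mul_of_nonneg_left (hιP μ) (norm_nonneg _))
    have i4 : -inner ℝ (D φ) (ι (μ - m₀ μ • one)) ≤
        ‖D‖ * (C₁ * ‖ι (φ - m₀ φ • one)‖) * (‖ι‖ * (C * ‖G μ‖)) := by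
      refine (neg_le_abs _).trans ((abs_real_inner_le_norm _ _).trans ?_)
      have : ‖D φ‖ ≤ ‖D‖ * (C₁ * ‖ι (φ - m₀ φ • one)‖) := by
        rw [← hDm]
        exact (D.le_opNorm _).trans (mul_le_mul_of_nonneg_left (hC₁ _) (norm_nonneg _))
      exact mul_le_mul this (hιP μ) (norm_nonneg _) (by positivity)
    have hti : 0 ≤ τ⁻¹ := (inv_pos.2 hτ).le
    have j1 := mul_le_mul_of_nonneg_left i1 (mul_nonneg hti (mul_nonneg ht0 hγ.le))
    have j2 := mul_le_mul_of_nonneg_left i2 (mul_nonneg hti (mul_nonneg ht0 hγ.le))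
    have j3 := mul_le_mul_of_nonneg_left i3 (mul_nonneg hti ht0)
    have j4 := mul_le_mul_of_nonneg_left i4 ht0
    have e3 : inner ℝ (ι μ) (ι (φ - m₀ φ • one)) = lam * ‖G φ‖ ^ 2 + t * γ *
        (inner ℝ (N φ) (ι (φ - m₀ φ • one)) - inner ℝ f (ι (φ - m₀ φ • one))) := by linarith
    rw [e3] at e1
    simp only [A, B, c₁, c₂, c₃, div_eq_mul_inv]
    linarith
  have hg₁ : ‖G φ‖ ≤ g₁ := by
    refine Real.le_sqrt_of_sq_le ((le_div_iff₀ hA).2 ?_)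
    have : 0 ≤ M / 2 * ‖G μ‖ ^ 2 := by positivity
    linarith
  have hg₂ : ‖G μ‖ ≤ g₂ := by
    refine Real.le_sqrt_of_sq_le ((le_div_iff₀ (half_pos hM)).2 ?_)
    have : 0 ≤ A * ‖G φ‖ ^ 2 := by positivity
    linarith
  have hφ : ‖φ‖ ≤ R₁ := by
    refine (hC φ).trans (mul_le_mul_of_nonneg_left (add_le_add hg₁ ?_) hC0)
    have e1 := key one 0
    simp only [map_zero, inner_zero_right, mul_zero, add_zero, sub_zero, hG1,
      inner_add_left, inner_sub_left, real_inner_smul_left] at e1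
    -- Mass need not be conserved, since the transport term is not assumed to have mean zero; its
    -- contribution is bounded through `‖G φ‖`.
    have e2 : inner ℝ (ι φ) (ι one) = t * (inner ℝ f (ι one) - τ * inner ℝ (D φ) (ι one)) := by
      field_simp at e1
      linarith
    have hD : ‖D φ‖ ≤ ‖D‖ * (C * g₁) := by
      rw [← hDm]
      refine (D.le_opNorm _).trans (mul_le_mul_of_nonneg_left ((hP φ).trans ?_) (norm_nonneg _))
      exact mul_le_mul_of_nonneg_left hg₁ hC0
    rw [e2, abs_mul, abs_of_nonneg ht0]
    refine (mul_le_of_le_one_left (abs_nonneg _) ht1).trans ((abs_sub _ _).trans ?_)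
    rw [abs_mul, abs_of_pos hτ]
    refine add_le_add (abs_real_inner_le_norm _ _) (mul_le_mul_of_nonneg_left ?_ hτ.le)
    exact (abs_real_inner_le_norm _ _).trans (mul_le_mul_of_nonneg_right hD (norm_nonneg _))
  have hμ : ‖μ‖ ≤ C * (g₂ + γ * ((Q₂ + ‖f‖) * ‖ι one‖)) := by
    refine (hC μ).trans (mul_le_mul_of_nonneg_left (add_le_add hg₂ ?_) hC0)
    have e1 := key 0 one
    simp only [map_zero, inner_zero_right, mul_zero, add_zero, sub_zero, hG1, zero_add,
      inner_sub_left, real_inner_smul_left] at e1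
    have e2 : inner ℝ (ι μ) (ι one) = t * (γ * inner ℝ (N φ - f) (ι one)) := by
      rw [inner_sub_left]
      linarith
    rw [e2, abs_mul, abs_of_nonneg ht0]
    refine (mul_le_of_le_one_left (abs_nonneg _) ht1).trans ?_
    rw [abs_mul, abs_of_pos hγ]
    refine mul_le_mul_of_nonneg_left ((abs_real_inner_le_norm _ _).trans ?_) hγ.le
    refine mul_le_mul_of_nonneg_right ((norm_sub_le _ _).trans ?_) (norm_nonneg _)
    exact add_le_add (hQ₂ φ (by simpa using hφ)) le_rfl
  exact max_le_max hφ hμ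

/-- Existence for the coupled Cahn–Hilliard step with an explicit convection term. -/
theorem exists_phaseField_solution (hι : Function.Injective ι)
    (hG : ∀ v, G v = 0 → ∃ c : ℝ, v = c • one) (hG1 : G one = 0) (hone : one ≠ 0)
    (hD1 : D one = 0) (hN : ContDiff ℝ 1 N) (hκ : 0 < κ)
    (hNc : ∀ v, ∀ c : ℝ, inner ℝ (ι (v - c • one)) (ι one) = 0 →
      κ * ‖ι (v - c • one)‖ ^ 4 ≤ inner ℝ (N v) (ι (v - c • one)))
    (hτ : 0 < τ) (hM : 0 < M) (hlam : 0 < lam) (hγ : 0 < γ) (f : H) :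
    ∃ φ μ : V, (∀ w, inner ℝ (τ⁻¹ • (ι φ - f)) (ι w) + inner ℝ (D φ) (ι w)
        + M * inner ℝ (G μ) (G w) = 0) ∧
      ∀ ψ, inner ℝ (ι μ) (ι ψ) - lam * inner ℝ (G φ) (G ψ) - γ * inner ℝ (N φ - f) (ι ψ) = 0 := by
  obtain ⟨L, hL⟩ := exists_phaseResidual_zero_equiv (ι := ι) (G := G) (D := D) (N := N) (f := f)
    (γ := γ) hι hτ hM hlam
  obtain ⟨R, hR⟩ := exists_phaseResidual_bound (f := f) hι hG hG1 hone hD1 hN.continuous hκ hNc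
    hτ hM hlam hγ
  obtain ⟨⟨φ, μ⟩, hx⟩ := exists_zero_of_homotopy L (contDiff_phaseResidual hN) hL hR
  have key : ∀ w ψ, phaseResidual ι G D N f τ M lam γ 1 (φ, μ) (w, ψ) = 0 := fun w ψ => by
    rw [hx]
    rfl
  simp only [phaseResidual_apply] at key
  refine ⟨φ, μ, fun w => ?_, fun ψ => ?_⟩
  · have := key w 0
    simp only [map_zero, inner_zero_right, mul_zero, add_zero, sub_zero, one_smul] at this
    rw [inner_add_left] at this
    exact this
  · have := key 0 ψ
    simp only [map_zero, inner_zero_right, mul_zero, add_zero, zero_add, one_mul,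
      inner_sub_left (ι μ), real_inner_smul_left] at this
    linarith

end PhaseField

end CHNS

namespace CHNS

open MeasureTheory Set Filter Topology

variable {d : ℕ} {Ω : Set (Pt d)} {𝒯 : Geometry.SimplicialComplex ℝ (Pt d)} {k l : ℕ}

/-! ### Polytopal domains and their triangulations -/

section Geometry

theorem IsConvexPolytopalDomain.isCompact_closure (hΩ : IsConvexPolytopalDomain Ω) :
    IsCompact (closure Ω) := by
  obtain ⟨V, hV⟩ := hΩ.polytope
  rw [hV]
  exact V.finite_toSet.isCompact_convexHull (𝕜 := ℝ)

theorem IsConvexPolytopalDomain.isFiniteMeasure (hΩ : IsConvexPolytopalDomain Ω) :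
    IsFiniteMeasure (volume.restrict Ω) :=
  ⟨by
    rw [Measure.restrict_apply_univ]
    exact (measure_mono subset_closure).trans_lt hΩ.isCompact_closure.measure_lt_top⟩

theorem IsTriangulation.finite_elements (h𝒯 : IsTriangulation 𝒯 Ω) : (elements 𝒯).Finite :=
  h𝒯.finite.subset fun _ hs => hs.1

theorem IsTriangulation.exists_mem_convexHull (h𝒯 : IsTriangulation 𝒯 Ω) {x : Pt d}
    (hx : x ∈ closure Ω) : ∃ s ∈ elements 𝒯, x ∈ convexHull ℝ (s : Set (Pt d)) := by
  rw [← h𝒯.space_eq, Geometry.SimplicialComplex.mem_space_iff] at hx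
  obtain ⟨s, hs, hx⟩ := hx
  obtain ⟨t, ht, hst⟩ := h𝒯.pure s hs
  exact ⟨t, ht, convexHull_mono (by exact_mod_cast hst) hx⟩

theorem IsTriangulation.convexHull_subset (h𝒯 : IsTriangulation 𝒯 Ω) {s : Finset (Pt d)}
    (hs : s ∈ elements 𝒯) : convexHull ℝ (s : Set (Pt d)) ⊆ closure Ω := by
  rw [← h𝒯.space_eq]
  exact Geometry.SimplicialComplex.convexHull_subset_space hs.1

theorem isCompact_element (s : Finset (Pt d)) : IsCompact (convexHull ℝ (s : Set (Pt d))) :=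
  s.finite_toSet.isCompact_convexHull (𝕜 := ℝ)

/-- Almost every point of the domain lies in the interior of an element. -/
theorem IsTriangulation.ae_mem_interior (hΩ : IsConvexPolytopalDomain Ω)
    (h𝒯 : IsTriangulation 𝒯 Ω) : ∀ᵐ x ∂volume.restrict Ω,
      ∃ s ∈ elements 𝒯, x ∈ interior (convexHull ℝ (s : Set (Pt d))) := by
  have h1 : ∀ᵐ x ∂(volume : Measure (Pt d)),
      ∀ s ∈ elements 𝒯, x ∉ frontier (convexHull ℝ (s : Set (Pt d))) := by
    rw [ae_ball_iff h𝒯.finite_elements.countable]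
    intro s _
    exact measure_eq_zero_iff_ae_notMem.1 (Convex.addHaar_frontier volume (convex_convexHull ℝ _))
  filter_upwards [ae_restrict_of_ae h1, ae_restrict_mem hΩ.isOpen.measurableSet] with x hx hxΩ
  obtain ⟨s, hs, hxs⟩ := h𝒯.exists_mem_convexHull (subset_closure hxΩ)
  refine ⟨s, hs, ?_⟩
  by_contra h
  exact hx s hs ⟨subset_closure hxs, h⟩

end Geometry

section Polynomial

theorem contDiff_mvPolynomial_eval (P : MvPolynomial (Fin d) ℝ) {n : WithTop ℕ∞} :
    ContDiff ℝ n fun x : Pt d => MvPolynomial.eval (fun i => x i) P := by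
  induction P using MvPolynomial.induction_on with
  | C a => simpa using contDiff_const
  | add p q hp hq => simpa using hp.add hq
  | mul_X p i hp =>
    simp only [map_mul, MvPolynomial.eval_X]
    exact hp.mul (by fun_prop)

end Polynomial

/-! ### Lagrange spaces: dimension, regularity, kernel of the gradient -/

section Lagrange

theorem lagrangeSpace_add {f g : Pt d → ℝ} (hf : f ∈ lagrangeSpace Ω 𝒯 k)
    (hg : g ∈ lagrangeSpace Ω 𝒯 k) : f + g ∈ lagrangeSpace Ω 𝒯 k := by
  refine ⟨hf.1.add hg.1, fun s hs => ?_, fun x hx => by simp [hf.2.2 x hx, hg.2.2 x hx]⟩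
  obtain ⟨P, hP, hfP⟩ := hf.2.1 s hs
  obtain ⟨Q, hQ, hgQ⟩ := hg.2.1 s hs
  exact ⟨P + Q, (MvPolynomial.totalDegree_add _ _).trans (max_le hP hQ),
    fun x hx => by simp [hfP x hx, hgQ x hx]⟩

theorem lagrangeSpace_smul (c : ℝ) {f : Pt d → ℝ} (hf : f ∈ lagrangeSpace Ω 𝒯 k) :
    c • f ∈ lagrangeSpace Ω 𝒯 k := by
  refine ⟨hf.1.const_smul c, fun s hs => ?_, fun x hx => by simp [hf.2.2 x hx]⟩
  obtain ⟨P, hP, hfP⟩ := hf.2.1 s hs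
  exact ⟨c • P, (MvPolynomial.totalDegree_smul_le _ _).trans hP,
    fun x hx => by simp [hfP x hx, MvPolynomial.smul_eval]⟩

theorem lagrangeSpace_mul {f g : Pt d → ℝ} (hf : f ∈ lagrangeSpace Ω 𝒯 k)
    (hg : g ∈ lagrangeSpace Ω 𝒯 l) : f * g ∈ lagrangeSpace Ω 𝒯 (k + l) := by
  refine ⟨hf.1.mul hg.1, fun s hs => ?_, fun x hx => by simp [hf.2.2 x hx]⟩
  obtain ⟨P, hP, hfP⟩ := hf.2.1 s hs
  obtain ⟨Q, hQ, hgQ⟩ := hg.2.1 s hs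
  exact ⟨P * Q, (MvPolynomial.totalDegree_mul _ _).trans (add_le_add hP hQ),
    fun x hx => by simp [hfP x hx, hgQ x hx]⟩

theorem indicator_one_mem_lagrangeSpace (h𝒯 : IsTriangulation 𝒯 Ω) :
    (closure Ω).indicator 1 ∈ lagrangeSpace Ω 𝒯 k := by
  refine ⟨?_, fun s hs => ⟨1, by simp, fun x hx => ?_⟩, fun x hx => by simp [hx]⟩
  · exact continuousOn_const.congr fun x hx => by rw [indicator_of_mem hx]; rfl
  · rw [indicator_of_mem (h𝒯.convexHull_subset hs hx)]
    simp

/-- The Lagrange space as a vector space. -/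
def lagrangeSubmodule (Ω : Set (Pt d)) (𝒯 : Geometry.SimplicialComplex ℝ (Pt d)) (k : ℕ) :
    Submodule ℝ (Pt d → ℝ) where
  carrier := lagrangeSpace Ω 𝒯 k
  add_mem' := lagrangeSpace_add
  zero_mem' := ⟨continuousOn_const, fun _ _ => ⟨0, by simp, fun _ _ => by simp⟩, fun _ _ => rfl⟩
  smul_mem' := fun c _ => lagrangeSpace_smul c

/-- The velocity space as a vector space. -/
def velocitySubmodule (Ω : Set (Pt d)) (𝒯 : Geometry.SimplicialComplex ℝ (Pt d)) (k : ℕ) :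
    Submodule ℝ (Pt d → Pt d) where
  carrier := velocitySpace Ω 𝒯 k
  add_mem' := fun hf hg => ⟨fun i => lagrangeSpace_add (hf.1 i) (hg.1 i),
    fun x hx => by simp [hf.2 x hx, hg.2 x hx]⟩
  zero_mem' := ⟨fun _ => (lagrangeSubmodule Ω 𝒯 k).zero_mem, fun _ _ => rfl⟩
  smul_mem' := fun c _ hf => ⟨fun i => lagrangeSpace_smul c (hf.1 i),
    fun x hx => by simp [hf.2 x hx]⟩

/-- The components of a velocity field. -/
def velocityComponent (Ω : Set (Pt d)) (𝒯 : Geometry.SimplicialComplex ℝ (Pt d)) (k : ℕ)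
    (i : Fin d) : velocitySubmodule Ω 𝒯 k →ₗ[ℝ] lagrangeSubmodule Ω 𝒯 k where
  toFun v := ⟨fun x => v.1 x i, v.2.1 i⟩
  map_add' _ _ := rfl
  map_smul' _ _ := rfl

/-- Restriction to the finitely many elements embeds the space in a product of images of polynomial
spaces of bounded degree. It is injective because the elements cover the closure and functions
vanish outside it. -/
theorem finiteDimensional_lagrangeSubmodule (h𝒯 : IsTriangulation 𝒯 Ω) :
    FiniteDimensional ℝ (lagrangeSubmodule Ω 𝒯 k) := by
  classical
  have : Finite (elements 𝒯) := h𝒯.finite_elements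
  let res : Set (Pt d) → (Pt d → ℝ) →ₗ[ℝ] (Pt d → ℝ) := fun A =>
    { toFun := fun f => A.indicator f
      map_add' := fun f g => indicator_add' A f g
      map_smul' := fun c f => indicator_const_smul A c f }
  let ev : MvPolynomial (Fin d) ℝ →ₗ[ℝ] (Pt d → ℝ) :=
    { toFun := fun P x => MvPolynomial.eval (fun i => x i) P
      map_add' := fun P Q => by ext; simp
      map_smul' := fun c P => by ext; simp [MvPolynomial.smul_eval] }
  let Y : elements 𝒯 → Submodule ℝ (Pt d → ℝ) := fun s =>
    (MvPolynomial.restrictTotalDegree (Fin d) ℝ k).map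
      (res (convexHull ℝ (s.1 : Set (Pt d))) ∘ₗ ev)
  let Φ : lagrangeSubmodule Ω 𝒯 k →ₗ[ℝ] ∀ s, Y s := LinearMap.pi fun s =>
    (res (convexHull ℝ (s.1 : Set (Pt d))) ∘ₗ (lagrangeSubmodule Ω 𝒯 k).subtype).codRestrict (Y s)
      fun v => by
        obtain ⟨P, hP, hvP⟩ := v.2.2.1 s.1 s.2
        refine ⟨P, (MvPolynomial.mem_restrictTotalDegree _ _ _).2 hP, ?_⟩
        ext x
        by_cases hx : x ∈ convexHull ℝ (s.1 : Set (Pt d))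
        · simp [res, ev, hx, hvP x hx]
        · simp [res, hx]
  have hΦ : Function.Injective Φ := by
    rw [← LinearMap.ker_eq_bot, LinearMap.ker_eq_bot']
    intro v hv
    ext x
    by_cases hx : x ∈ closure Ω
    · obtain ⟨s, hs, hxs⟩ := h𝒯.exists_mem_convexHull hx
      have h1 : (Φ v ⟨s, hs⟩).1 x = 0 := by rw [hv]; rfl
      simpa [Φ, res, hxs] using h1
    · exact v.2.2.2 x hx
  exact Module.Finite.of_injective Φ hΦ

theorem finiteDimensional_velocitySubmodule (h𝒯 : IsTriangulation 𝒯 Ω) :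
    FiniteDimensional ℝ (velocitySubmodule Ω 𝒯 k) := by
  have := finiteDimensional_lagrangeSubmodule (k := k) h𝒯
  refine Module.Finite.of_injective (LinearMap.pi (velocityComponent Ω 𝒯 k)) ?_
  intro v w hvw
  ext x i
  exact congrFun (congrArg Subtype.val (congrFun hvw i)) x

/-- On the interior of an element a Lagrange function agrees locally with a polynomial. -/
theorem exists_eventuallyEq_polynomial {f : Pt d → ℝ} (hf : f ∈ lagrangeSpace Ω 𝒯 k)
    {s : Finset (Pt d)} (hs : s ∈ elements 𝒯) : ∃ P : MvPolynomial (Fin d) ℝ,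
      (∀ x ∈ convexHull ℝ (s : Set (Pt d)), f x = MvPolynomial.eval (fun i => x i) P) ∧
      ∀ x ∈ interior (convexHull ℝ (s : Set (Pt d))),
        f =ᶠ[𝓝 x] fun y => MvPolynomial.eval (fun i => y i) P := by
  obtain ⟨P, -, hP⟩ := hf.2.1 s hs
  refine ⟨P, hP, fun x hx => ?_⟩
  filter_upwards [mem_interior_iff_mem_nhds.1 hx] with y hy using hP y hy

theorem differentiableAt_of_mem_interior {f : Pt d → ℝ} (hf : f ∈ lagrangeSpace Ω 𝒯 k)
    {s : Finset (Pt d)} (hs : s ∈ elements 𝒯) {x : Pt d}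
    (hx : x ∈ interior (convexHull ℝ (s : Set (Pt d)))) : DifferentiableAt ℝ f x := by
  obtain ⟨P, -, hP⟩ := exists_eventuallyEq_polynomial hf hs
  exact (hP x hx).differentiableAt_iff.2
    ((contDiff_mvPolynomial_eval P (n := 1)).differentiable one_ne_zero x)

theorem ae_differentiableAt_lagrange (hΩ : IsConvexPolytopalDomain Ω) (h𝒯 : IsTriangulation 𝒯 Ω)
    {f : Pt d → ℝ} (hf : f ∈ lagrangeSpace Ω 𝒯 k) :
    ∀ᵐ x ∂volume.restrict Ω, DifferentiableAt ℝ f x := by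
  filter_upwards [IsTriangulation.ae_mem_interior hΩ h𝒯] with x ⟨s, hs, hx⟩
  exact differentiableAt_of_mem_interior hf hs hx

theorem memLp_top_lagrange (hΩ : IsConvexPolytopalDomain Ω) {f : Pt d → ℝ}
    (hf : f ∈ lagrangeSpace Ω 𝒯 k) : MemLp f ⊤ (volume.restrict Ω) := by
  obtain ⟨C, hC⟩ := hΩ.isCompact_closure.exists_bound_of_continuousOn hf.1
  refine memLp_top_of_bound
    ((hf.1.mono subset_closure).aestronglyMeasurable hΩ.isOpen.measurableSet) C ?_
  filter_upwards [ae_restrict_mem hΩ.isOpen.measurableSet] with x hx using hC x (subset_closure hx)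

theorem norm_gradient_eq_norm_fderiv (f : Pt d → ℝ) (x : Pt d) :
    ‖gradient f x‖ = ‖fderiv ℝ f x‖ := by
  rw [← toDual_gradient, LinearIsometryEquiv.norm_map]

theorem measurable_gradient (f : Pt d → ℝ) : Measurable (gradient f) :=
  ((InnerProductSpace.toDual ℝ (Pt d)).symm.continuous.measurable).comp (measurable_fderiv ℝ f)

theorem memLp_top_gradient (hΩ : IsConvexPolytopalDomain Ω) (h𝒯 : IsTriangulation 𝒯 Ω)
    {f : Pt d → ℝ} (hf : f ∈ lagrangeSpace Ω 𝒯 k) :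
    MemLp (gradient f) ⊤ (volume.restrict Ω) := by
  have h1 : ∀ s ∈ elements 𝒯, ∃ C : ℝ,
      ∀ x ∈ interior (convexHull ℝ (s : Set (Pt d))), ‖gradient f x‖ ≤ C := by
    intro s hs
    obtain ⟨P, -, hP⟩ := exists_eventuallyEq_polynomial hf hs
    obtain ⟨C, hC⟩ := (isCompact_element s).exists_bound_of_continuousOn
      ((contDiff_mvPolynomial_eval P (n := 1)).continuous_fderiv one_ne_zero).continuousOn
    refine ⟨C, fun x hx => ?_⟩
    rw [norm_gradient_eq_norm_fderiv, (hP x hx).fderiv_eq]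
    exact hC x (interior_subset hx)
  choose! C hC using h1
  obtain ⟨M, hM⟩ := (h𝒯.finite_elements.image C).bddAbove
  refine memLp_top_of_bound (measurable_gradient f).aestronglyMeasurable M ?_
  filter_upwards [IsTriangulation.ae_mem_interior hΩ h𝒯] with x ⟨s, hs, hx⟩
  exact (hC s hs x hx).trans (hM (mem_image_of_mem C hs))

/-- A Lagrange function that vanishes almost everywhere on the domain is zero. -/
theorem lagrange_eq_zero_of_ae (hΩ : IsConvexPolytopalDomain Ω) {f : Pt d → ℝ}
    (hf : f ∈ lagrangeSpace Ω 𝒯 k) (h : f =ᵐ[volume.restrict Ω] 0) : f = 0 := by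
  have h1 : EqOn f 0 Ω := Measure.eqOn_open_of_ae_eq h hΩ.isOpen (hf.1.mono subset_closure)
    continuousOn_const
  have h2 : EqOn f 0 (closure Ω) :=
    h1.of_subset_closure hf.1 continuousOn_const subset_closure subset_rfl
  ext x
  by_cases hx : x ∈ closure Ω
  · exact h2 hx
  · exact hf.2.2 x hx

/-- A Lagrange function with vanishing gradient is constant on the domain. -/
theorem lagrange_eq_const_of_gradient_ae_zero (hΩ : IsConvexPolytopalDomain Ω)
    (h𝒯 : IsTriangulation 𝒯 Ω) {f : Pt d → ℝ} (hf : f ∈ lagrangeSpace Ω 𝒯 k)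
    (h : gradient f =ᵐ[volume.restrict Ω] 0) : ∃ c : ℝ, f = c • (closure Ω).indicator 1 := by
  have h1 : ∀ s ∈ elements 𝒯, ∃ c : ℝ,
      ∀ x ∈ interior (convexHull ℝ (s : Set (Pt d))) ∩ Ω, f x = c := by
    intro s hs
    set U := interior (convexHull ℝ (s : Set (Pt d))) ∩ Ω
    obtain ⟨P, hPs, hP⟩ := exists_eventuallyEq_polynomial hf hs
    have hU : IsOpen U := isOpen_interior.inter hΩ.isOpen
    have hUc : Convex ℝ U := (convex_convexHull ℝ _).interior.inter hΩ.convex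
    have hPd := contDiff_mvPolynomial_eval P (n := 1)
    have h2 : EqOn (fderiv ℝ fun y : Pt d => MvPolynomial.eval (fun i => y i) P) 0 U := by
      refine Measure.eqOn_open_of_ae_eq (μ := volume) ?_ hU
        (hPd.continuous_fderiv one_ne_zero).continuousOn continuousOn_const
      filter_upwards [ae_restrict_of_ae_restrict_of_subset inter_subset_right h,
        ae_restrict_mem hU.measurableSet] with x hx hxU
      rw [← (hP x hxU.1).fderiv_eq, ← toDual_gradient, hx]
      simp
    obtain ⟨c, hc⟩ := hU.exists_is_const_of_fderiv_eq_zero hUc.isPreconnected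
      (hPd.differentiable one_ne_zero).differentiableOn h2
    exact ⟨c, fun x hx => by rw [hPs x (interior_subset hx.1), hc x hx]⟩
  choose! c hc using h1
  -- The values of `f` lie in the finite set `A` on a dense subset of `Ω`, hence on `Ω`. A connected
  -- set has a one-point image in a finite set, so no chain of neighbouring elements has to be
  -- built.
  set A := c '' elements 𝒯
  have hA : A.Finite := h𝒯.finite_elements.image c
  set D := Ω ∩ {x | ∃ s ∈ elements 𝒯, x ∈ interior (convexHull ℝ (s : Set (Pt d)))}
  have hD : Ω ⊆ closure D := by
    intro x hx
    rw [mem_closure_iff]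
    intro W hW hxW
    by_contra hne
    have h3 : volume (W ∩ Ω) = 0 := by
      rw [measure_eq_zero_iff_ae_notMem]
      have h4 := (ae_restrict_iff' hΩ.isOpen.measurableSet).1
        (IsTriangulation.ae_mem_interior hΩ h𝒯)
      filter_upwards [h4] with y hy hyW
      exact hne ⟨y, hyW.1, hyW.2, hy hyW.2⟩
    exact ((hW.inter hΩ.isOpen).measure_pos volume ⟨x, hxW, hx⟩).ne' h3
  have hfA : MapsTo f Ω A := by
    have h3 : MapsTo f D A := by
      rintro x ⟨hxΩ, s, hs, hxs⟩
      rw [hc s hs x ⟨hxs, hxΩ⟩]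
      exact mem_image_of_mem c hs
    intro x hx
    have hcont : ContinuousWithinAt f D x :=
      ((hf.1.mono subset_closure) x hx).mono inter_subset_left
    exact hA.isClosed.closure_subset (hcont.mem_closure (hD hx) h3)
  have hsub : (f '' Ω).Subsingleton :=
    hA.countable.isTotallyDisconnected (f '' Ω) (image_subset_iff.2 hfA)
      (hΩ.convex.isPreconnected.image f (hf.1.mono subset_closure))
  obtain ⟨x₀, hx₀⟩ := hΩ.nonempty
  refine ⟨f x₀, ?_⟩
  have h5 : f + (-f x₀) • (closure Ω).indicator 1 = 0 := by
    refine lagrange_eq_zero_of_ae hΩ (lagrangeSpace_add hf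
      (lagrangeSpace_smul _ (indicator_one_mem_lagrangeSpace h𝒯))) ?_
    filter_upwards [ae_restrict_mem hΩ.isOpen.measurableSet] with x hx
    simp [subset_closure hx, hsub (mem_image_of_mem f hx) (mem_image_of_mem f hx₀)]
  rwa [neg_smul, ← sub_eq_add_neg, sub_eq_zero] at h5

/-- A Lagrange function that vanishes on the boundary is Lipschitz continuous on the whole
space. -/
theorem exists_lipschitzWith_lagrange (hΩ : IsConvexPolytopalDomain Ω)
    (h𝒯 : IsTriangulation 𝒯 Ω) {f : Pt d → ℝ} (hf : f ∈ lagrangeSpace Ω 𝒯 k)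
    (h0 : ∀ x ∈ frontier Ω, f x = 0) : ∃ K, LipschitzWith K f := by
  have hout : ∀ x ∈ Ωᶜ, f x = 0 := by
    intro x hx
    by_cases hxc : x ∈ closure Ω
    · exact h0 x (by rw [hΩ.isOpen.frontier_eq]; exact ⟨hxc, hx⟩)
    · exact hf.2.2 x hxc
  have hcont : Continuous f := by
    have h1 : ContinuousOn f (closure Ω ∪ Ωᶜ) :=
      hf.1.union_of_isClosed ((continuousOn_const (c := (0 : ℝ))).congr hout) isClosed_closure
        hΩ.isOpen.isClosed_compl
    have h2 : closure Ω ∪ Ωᶜ = univ :=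
      univ_subset_iff.1 ((union_compl_self Ω).symm.subset.trans
        (union_subset_union_left _ subset_closure))
    rwa [h2, continuousOn_univ] at h1
  have hfin : Finite (elements 𝒯) := h𝒯.finite_elements
  have hL : ∀ s : elements 𝒯, ∃ K, LipschitzOnWith K f (convexHull ℝ (s.1 : Set (Pt d))) := by
    intro s
    obtain ⟨P, -, hP⟩ := hf.2.1 s.1 s.2
    obtain ⟨K, hK⟩ := (contDiff_mvPolynomial_eval P (n := 1)).contDiffOn.exists_lipschitzOnWith
      one_ne_zero (convex_convexHull ℝ (s.1 : Set (Pt d))) (isCompact_element s.1)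
    refine ⟨K, fun x hx y hy => ?_⟩
    rw [hP x hx, hP y hy]
    exact hK hx hy
  choose K hK using hL
  obtain ⟨M, hM⟩ := (finite_range K).bddAbove
  refine ⟨M, lipschitzWith_of_finite_closed_cover hcont
    (fun o : Option (elements 𝒯) => o.elim Ωᶜ fun s => convexHull ℝ (s.1 : Set (Pt d))) ?_ ?_ ?_⟩
  · rintro (_ | s)
    · exact hΩ.isOpen.isClosed_compl
    · exact (isCompact_element s.1).isClosed
  · refine eq_univ_of_forall fun x => ?_
    rw [mem_iUnion]
    by_cases hx : x ∈ Ω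
    · obtain ⟨s, hs, hxs⟩ := h𝒯.exists_mem_convexHull (subset_closure hx)
      exact ⟨some ⟨s, hs⟩, hxs⟩
    · exact ⟨none, hx⟩
  · rintro (_ | s)
    · intro x hx y hy
      simp [hout x hx, hout y hy]
    · exact (hK s).weaken (hM (mem_range_self s))

/-- The derivatives of a Lagrange function vanishing on the boundary have mean zero. -/
theorem integral_gradient_eq_zero (hΩ : IsConvexPolytopalDomain Ω)
    (h𝒯 : IsTriangulation 𝒯 Ω) {f : Pt d → ℝ} (hf : f ∈ lagrangeSpace Ω 𝒯 k)
    (h0 : ∀ x ∈ frontier Ω, f x = 0) (i : Fin d) : ∫ x in Ω, gradient f x i = 0 := by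
  obtain ⟨K, hK⟩ := exists_lipschitzWith_lagrange hΩ h𝒯 hf h0
  have hsupp : HasCompactSupport f :=
    HasCompactSupport.intro hΩ.isCompact_closure fun x hx => hf.2.2 x hx
  set v : Pt d := EuclideanSpace.single i 1
  -- Integration by parts for Lipschitz functions, against the constant `1`. The direction `-v`
  -- becomes `v` on the side of `f`.
  have h1 := LipschitzWith.integral_lineDeriv_mul_eq (μ := volume)
    (LipschitzWith.const (1 : ℝ)) hK hsupp (-v)
  have h2 : ∫ x, lineDeriv ℝ f x v = 0 := by
    have h3 : ∀ x w : Pt d, lineDeriv ℝ (fun _ : Pt d => (1 : ℝ)) x w = 0 := fun x w => by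
      simp [lineDeriv]
    simpa [h3] using h1.symm
  rw [← h2, ← integral_indicator hΩ.isOpen.measurableSet]
  refine integral_congr_ae ?_
  have h3 := measure_eq_zero_iff_ae_notMem.1 (Convex.addHaar_frontier volume hΩ.convex)
  have h4 := (ae_restrict_iff' hΩ.isOpen.measurableSet).1 (ae_differentiableAt_lagrange hΩ h𝒯 hf)
  filter_upwards [h3, h4] with x hx hd
  by_cases hxΩ : x ∈ Ω
  · rw [indicator_of_mem hxΩ, (hd hxΩ).lineDeriv_eq_fderiv, ← toDual_gradient,
      InnerProductSpace.toDual_apply_apply, EuclideanSpace.inner_single_right]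
    simp
  · rw [indicator_of_notMem hxΩ]
    have hxc : x ∉ closure Ω := fun hc => hx (by rw [hΩ.isOpen.frontier_eq]; exact ⟨hc, hxΩ⟩)
    have h5 : f =ᶠ[𝓝 x] fun _ => 0 := by
      filter_upwards [isClosed_closure.isOpen_compl.mem_nhds hxc] with y hy using hf.2.2 y hy
    rw [h5.lineDeriv_eq]
    simp [lineDeriv]

end Lagrange

end CHNS

namespace CHNS

open MeasureTheory Set Filter Topology

variable {d : ℕ} {Ω : Set (Pt d)} {𝒯 : Geometry.SimplicialComplex ℝ (Pt d)} {k l : ℕ}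

/-! ### Essentially bounded functions and coercivity of the cube -/

section Bounded

variable {α F : Type*} [MeasurableSpace α] {μ : Measure α} [NormedAddCommGroup F]

theorem exists_ae_bound_of_memLp_top {f : α → F} (hf : MemLp f ⊤ μ) :
    ∃ C : ℝ, ∀ᵐ x ∂μ, ‖f x‖ ≤ C := by
  refine ⟨(eLpNormEssSup f μ).toReal, ?_⟩
  have h1 : eLpNormEssSup f μ ≠ ⊤ := by simpa using hf.2.ne
  filter_upwards [ae_le_eLpNormEssSup (f := f) (μ := μ)] with x hx
  rw [← toReal_enorm]
  exact ENNReal.toReal_mono h1 hx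

theorem memLp_top_inner [InnerProductSpace ℝ F] {f g : α → F} (hf : MemLp f ⊤ μ)
    (hg : MemLp g ⊤ μ) : MemLp (fun x => inner ℝ (f x) (g x)) ⊤ μ := by
  obtain ⟨C, hC⟩ := exists_ae_bound_of_memLp_top hf
  obtain ⟨D, hD⟩ := exists_ae_bound_of_memLp_top hg
  refine memLp_top_of_bound (hf.1.inner hg.1) (C * D) ?_
  filter_upwards [hC, hD] with x hx hy
  exact (norm_inner_le_norm _ _).trans
    (mul_le_mul hx hy (norm_nonneg _) ((norm_nonneg _).trans hx))

theorem memLp_top_mul {f g : α → ℝ} (hf : MemLp f ⊤ μ) (hg : MemLp g ⊤ μ) :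
    MemLp (fun x => f x * g x) ⊤ μ := by
  simpa [mul_comm] using memLp_top_inner hf hg

theorem memLp_top_of_components {f : α → Pt d} (hf : ∀ i, MemLp (fun x => f x i) ⊤ μ) :
    MemLp f ⊤ μ := by
  have h : f = fun x => ∑ i, f x i • EuclideanSpace.single i (1 : ℝ) := by
    ext x j
    simp [Pi.single_apply]
  rw [h]
  refine memLp_finsetSum _ fun i _ => ?_
  exact (ContinuousLinearMap.toSpanSingleton ℝ (EuclideanSpace.single i (1 : ℝ))).comp_memLp' (hf i)

/-- The quartic coercivity of the cube against deviations from the mean. -/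
theorem sq_integral_sq_le_integral_cube_mul [IsFiniteMeasure μ] (hμ : 0 < μ.real univ)
    {f : α → ℝ} (hf : MemLp f ⊤ μ) {c : ℝ} (hc : ∫ x, (f x - c) ∂μ = 0) :
    1 / (4 * μ.real univ) * (∫ x, (f x - c) * (f x - c) ∂μ) ^ 2
      ≤ ∫ x, f x * f x * f x * (f x - c) ∂μ := by
  set g : α → ℝ := fun x => f x - c
  have hg : MemLp g ⊤ μ := hf.sub (memLp_const c)
  have hg2 : MemLp (fun x => g x * g x) ⊤ μ := memLp_top_mul hg hg
  set A := ∫ x, g x * g x ∂μ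
  set s := A / μ.real univ
  have hI : ∀ {q : α → ℝ}, MemLp q ⊤ μ → Integrable q μ := fun h => h.integrable le_top
  have i1 : Integrable (fun x => c ^ 3 * g x) μ := (hI hg).const_mul _
  have i2 : Integrable (fun x => s / 2 * (g x * g x)) μ := (hI hg2).const_mul _
  have i3 : Integrable (fun _ : α => s ^ 2 / 4) μ := integrable_const _
  -- With `a = g x`, `(a + c)³ a - c³ a = a⁴/4 + 3 a² (c + a/2)²`, and `a⁴/4 ≥ s a²/2 - s²/4`. The
  -- mean `s` of `g²` is the optimal parameter, and the term `c³ g` integrates to zero.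
  have h1 : ∫ x, (c ^ 3 * g x + s / 2 * (g x * g x) - s ^ 2 / 4) ∂μ
      ≤ ∫ x, f x * f x * f x * g x ∂μ := by
    refine integral_mono ((i1.add i2).sub i3)
      (hI (memLp_top_mul (memLp_top_mul (memLp_top_mul hf hf) hf) hg)) fun x => ?_
    have e1 : f x = g x + c := by simp [g]
    simp only [e1]
    generalize g x = a
    nlinarith [sq_nonneg (a ^ 2 / 2 - s / 2), sq_nonneg (a * (a + 2 * c)), sq_nonneg (a * c),
      sq_nonneg (a * (a / 2 + c)), sq_nonneg (a * (3 * a / 2 + 3 * c))]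
  have h2 : ∫ x, (c ^ 3 * g x + s / 2 * (g x * g x) - s ^ 2 / 4) ∂μ =
      1 / (4 * μ.real univ) * A ^ 2 := by
    have e2 := integral_sub (i1.add i2) i3
    simp only [Pi.add_apply] at e2
    rw [e2, integral_add i1 i2, integral_const_mul, integral_const_mul,
      hc, integral_const, show ∫ x, g x * g x ∂μ = A from rfl]
    simp only [s, smul_eq_mul]
    field_simp
    ring
  linarith

end Bounded

/-! ### Finite element operators as linear maps into `L²` -/

section LpMaps

theorem coe_mem_lagrangeSpace (v : lagrangeSubmodule Ω 𝒯 k) : v.1 ∈ lagrangeSpace Ω 𝒯 k := v.2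

theorem coe_mem_velocitySpace (v : velocitySubmodule Ω 𝒯 k) : v.1 ∈ velocitySpace Ω 𝒯 k := v.2

variable {V F : Type*} [AddCommGroup V] [Module ℝ V] [NormedAddCommGroup F]
  [InnerProductSpace ℝ F]

/-- A family of bounded functions depending linearly on a parameter, up to null sets, is a linear
map into `L²`. -/
theorem exists_linearMap_toLp (hΩ : IsConvexPolytopalDomain Ω) (T : V → Pt d → F)
    (hT : ∀ v, MemLp (T v) ⊤ (volume.restrict Ω))
    (hadd : ∀ v w, T (v + w) =ᵐ[volume.restrict Ω] T v + T w)
    (hsmul : ∀ (c : ℝ) v, T (c • v) =ᵐ[volume.restrict Ω] c • T v) :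
    ∃ J : V →ₗ[ℝ] Lp F 2 (volume.restrict Ω), ∀ v, J v =ᵐ[volume.restrict Ω] T v := by
  have := hΩ.isFiniteMeasure
  have hT2 : ∀ v, MemLp (T v) 2 (volume.restrict Ω) := fun v => (hT v).mono_exponent le_top
  refine ⟨{ toFun := fun v => (hT2 v).toLp (T v), map_add' := fun v w => ?_,
            map_smul' := fun c v => ?_ }, fun v => (hT2 v).coeFn_toLp⟩
  · rw [← MemLp.toLp_add]
    exact MemLp.toLp_congr _ _ (hadd v w)
  · rw [RingHom.id_apply, ← MemLp.toLp_const_smul]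
    exact MemLp.toLp_congr _ _ (hsmul c v)

/-- The bridge from the integrals of the scheme to the Hilbert space inner products of the abstract
arguments. -/
theorem l2_eq_inner {f g : Pt d → F} {a b : Lp F 2 (volume.restrict Ω)}
    (ha : a =ᵐ[volume.restrict Ω] f) (hb : b =ᵐ[volume.restrict Ω] g) :
    l2 Ω f g = inner ℝ a b := by
  rw [L2.inner_def, l2]
  refine integral_congr_ae ?_
  filter_upwards [ha, hb] with x hx hy
  rw [hx, hy]

theorem gradient_add_ae (hΩ : IsConvexPolytopalDomain Ω) (h𝒯 : IsTriangulation 𝒯 Ω)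
    {f g : Pt d → ℝ} (hf : f ∈ lagrangeSpace Ω 𝒯 k) (hg : g ∈ lagrangeSpace Ω 𝒯 l) :
    gradient (f + g) =ᵐ[volume.restrict Ω] gradient f + gradient g := by
  filter_upwards [ae_differentiableAt_lagrange hΩ h𝒯 hf, ae_differentiableAt_lagrange hΩ h𝒯 hg]
    with x hx hy
  simp [gradient, fderiv_add hx hy]

theorem gradient_smul_ae (hΩ : IsConvexPolytopalDomain Ω) (h𝒯 : IsTriangulation 𝒯 Ω)
    (c : ℝ) {f : Pt d → ℝ} (hf : f ∈ lagrangeSpace Ω 𝒯 k) :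
    gradient (c • f) =ᵐ[volume.restrict Ω] c • gradient f := by
  filter_upwards [ae_differentiableAt_lagrange hΩ h𝒯 hf] with x hx
  simp [gradient, fderiv_const_smul hx]

theorem memLp_top_velocity (hΩ : IsConvexPolytopalDomain Ω) {v : Pt d → Pt d}
    (hv : v ∈ velocitySpace Ω 𝒯 k) : MemLp v ⊤ (volume.restrict Ω) :=
  memLp_top_of_components fun i => memLp_top_lagrange hΩ (hv.1 i)

theorem exists_massMap (hΩ : IsConvexPolytopalDomain Ω) :
    ∃ J : lagrangeSubmodule Ω 𝒯 k →ₗ[ℝ] Lp ℝ 2 (volume.restrict Ω),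
      ∀ v, J v =ᵐ[volume.restrict Ω] v.1 :=
  exists_linearMap_toLp hΩ (V := lagrangeSubmodule Ω 𝒯 k)
    (fun v => v.1) (fun v => memLp_top_lagrange hΩ (coe_mem_lagrangeSpace v))
    (fun _ _ => .rfl) fun _ _ => .rfl

theorem exists_gradMap (hΩ : IsConvexPolytopalDomain Ω) (h𝒯 : IsTriangulation 𝒯 Ω) :
    ∃ G : lagrangeSubmodule Ω 𝒯 k →ₗ[ℝ] Lp (Pt d) 2 (volume.restrict Ω),
      ∀ v, G v =ᵐ[volume.restrict Ω] gradient v.1 :=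
  exists_linearMap_toLp hΩ (V := lagrangeSubmodule Ω 𝒯 k)
    (fun v => gradient v.1) (fun v => memLp_top_gradient hΩ h𝒯 (coe_mem_lagrangeSpace v))
    (fun v w => gradient_add_ae hΩ h𝒯 (coe_mem_lagrangeSpace v) (coe_mem_lagrangeSpace w)) fun c v => gradient_smul_ae hΩ h𝒯 c (coe_mem_lagrangeSpace v)

theorem exists_transportMap (hΩ : IsConvexPolytopalDomain Ω) (h𝒯 : IsTriangulation 𝒯 Ω)
    {u : Pt d → Pt d} (hu : MemLp u ⊤ (volume.restrict Ω)) :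
    ∃ D : lagrangeSubmodule Ω 𝒯 k →ₗ[ℝ] Lp ℝ 2 (volume.restrict Ω),
      ∀ v, D v =ᵐ[volume.restrict Ω] fun x => inner ℝ (gradient v.1 x) (u x) := by
  refine exists_linearMap_toLp hΩ (V := lagrangeSubmodule Ω 𝒯 k)
    (fun v x => inner ℝ (gradient v.1 x) (u x))
    (fun v => memLp_top_inner (memLp_top_gradient hΩ h𝒯 (coe_mem_lagrangeSpace v)) hu) (fun v w => ?_) fun c v => ?_
  · filter_upwards [gradient_add_ae hΩ h𝒯 (coe_mem_lagrangeSpace v) (coe_mem_lagrangeSpace w)] with x hx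
    simp only [Submodule.coe_add, hx, Pi.add_apply, inner_add_left]
  · filter_upwards [gradient_smul_ae hΩ h𝒯 c (coe_mem_lagrangeSpace v)] with x hx
    simp only [Submodule.coe_smul, hx, Pi.smul_apply, real_inner_smul_left, smul_eq_mul]

theorem exists_velocityMap (hΩ : IsConvexPolytopalDomain Ω) :
    ∃ J : velocitySubmodule Ω 𝒯 k →ₗ[ℝ] Lp (Pt d) 2 (volume.restrict Ω),
      ∀ v, J v =ᵐ[volume.restrict Ω] v.1 :=
  exists_linearMap_toLp hΩ (V := velocitySubmodule Ω 𝒯 k)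
    (fun v => v.1) (fun v => memLp_top_velocity hΩ (coe_mem_velocitySpace v))
    (fun _ _ => .rfl) fun _ _ => .rfl

theorem exists_convectMap (hΩ : IsConvexPolytopalDomain Ω) (h𝒯 : IsTriangulation 𝒯 Ω)
    {u : Pt d → Pt d} (hu : MemLp u ⊤ (volume.restrict Ω)) :
    ∃ D : velocitySubmodule Ω 𝒯 k →ₗ[ℝ] Lp (Pt d) 2 (volume.restrict Ω),
      ∀ v, D v =ᵐ[volume.restrict Ω] convect u v.1 := by
  refine exists_linearMap_toLp hΩ (V := velocitySubmodule Ω 𝒯 k)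
    (fun v => convect u v.1)
    (fun v => memLp_top_of_components fun i =>
      memLp_top_inner hu (memLp_top_gradient hΩ h𝒯 ((coe_mem_velocitySpace v).1 i))) (fun v w => ?_) fun c v => ?_
  · filter_upwards [ae_all_iff.2 fun i => gradient_add_ae hΩ h𝒯 ((coe_mem_velocitySpace v).1 i) ((coe_mem_velocitySpace w).1 i)] with x hx
    ext i
    exact (congrArg (fun z => inner ℝ (u x) z) (hx i)).trans (inner_add_right _ _ _)
  · filter_upwards [ae_all_iff.2 fun i => gradient_smul_ae hΩ h𝒯 c ((coe_mem_velocitySpace v).1 i)] with x hx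
    ext i
    exact (congrArg (fun z => inner ℝ (u x) z) (hx i)).trans (real_inner_smul_right _ _ _)

theorem exists_pairingMap (hΩ : IsConvexPolytopalDomain Ω) {w : Pt d → Pt d}
    (hw : MemLp w ⊤ (volume.restrict Ω)) :
    ∃ D : velocitySubmodule Ω 𝒯 k →ₗ[ℝ] Lp ℝ 2 (volume.restrict Ω),
      ∀ v, D v =ᵐ[volume.restrict Ω] fun x => inner ℝ (w x) (v.1 x) :=
  exists_linearMap_toLp hΩ (V := velocitySubmodule Ω 𝒯 k)
    (fun v x => inner ℝ (w x) (v.1 x))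
    (fun v => memLp_top_inner hw (memLp_top_velocity hΩ (coe_mem_velocitySpace v)))
    (fun _ _ => .of_forall fun _ => inner_add_right _ _ _)
    fun _ _ => .of_forall fun _ => real_inner_smul_right _ _ _

theorem massMap_injective (hΩ : IsConvexPolytopalDomain Ω)
    {J : lagrangeSubmodule Ω 𝒯 k →ₗ[ℝ] Lp ℝ 2 (volume.restrict Ω)}
    (hJ : ∀ v, J v =ᵐ[volume.restrict Ω] v.1) : Function.Injective J := by
  rw [← LinearMap.ker_eq_bot, LinearMap.ker_eq_bot']
  intro v hv
  refine Subtype.ext (lagrange_eq_zero_of_ae hΩ (coe_mem_lagrangeSpace v) ?_)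
  have h := hJ v
  rw [hv] at h
  exact h.symm.trans (Lp.coeFn_zero _ _ _)

theorem velocityMap_injective (hΩ : IsConvexPolytopalDomain Ω)
    {J : velocitySubmodule Ω 𝒯 k →ₗ[ℝ] Lp (Pt d) 2 (volume.restrict Ω)}
    (hJ : ∀ v, J v =ᵐ[volume.restrict Ω] v.1) : Function.Injective J := by
  rw [← LinearMap.ker_eq_bot, LinearMap.ker_eq_bot']
  intro v hv
  have h := hJ v
  rw [hv] at h
  have h1 := h.symm.trans (Lp.coeFn_zero _ _ _)
  ext x i
  refine congrFun (lagrange_eq_zero_of_ae hΩ ((coe_mem_velocitySpace v).1 i) ?_) x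
  filter_upwards [h1] with y hy
  rw [hy]
  rfl

end LpMaps

/-- Discrete integration by parts: the velocities vanish on the boundary. -/
theorem l2_divergence_eq_neg (hΩ : IsConvexPolytopalDomain Ω) (h𝒯 : IsTriangulation 𝒯 Ω)
    {v : Pt d → Pt d} (hv : v ∈ velocitySpace Ω 𝒯 k) {q : Pt d → ℝ}
    (hq : q ∈ lagrangeSpace Ω 𝒯 l) : l2 Ω (divergence v) q = -l2 Ω (gradient q) v := by
  have := hΩ.isFiniteMeasure
  -- Each product `vᵢ q` is again a Lagrange function, of higher degree, and vanishes on the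
  -- boundary, so its derivatives have mean zero.
  have hvq : ∀ i, (fun x => v x i) * q ∈ lagrangeSpace Ω 𝒯 (k + l) := fun i =>
    lagrangeSpace_mul (hv.1 i) hq
  have h0 : ∀ i, ∫ x in Ω, gradient ((fun x => v x i) * q) x i = 0 := fun i =>
    integral_gradient_eq_zero hΩ h𝒯 (hvq i) (fun x hx => by simp [hv.2 x hx]) i
  have hcomp : ∀ {g : Pt d → Pt d} (i : Fin d), MemLp g ⊤ (volume.restrict Ω) →
      MemLp (fun x => g x i) ⊤ (volume.restrict Ω) := fun i hg =>
    (EuclideanSpace.proj i : Pt d →L[ℝ] ℝ).comp_memLp' hg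
  have hdiv : MemLp (divergence v) ⊤ (volume.restrict Ω) :=
    memLp_finsetSum _ fun i _ => hcomp i (memLp_top_gradient hΩ h𝒯 (hv.1 i))
  have i1 : Integrable (fun x => inner ℝ (divergence v x) (q x)) (volume.restrict Ω) :=
    (memLp_top_inner hdiv (memLp_top_lagrange hΩ hq)).integrable le_top
  have i2 : Integrable (fun x => inner ℝ (gradient q x) (v x)) (volume.restrict Ω) :=
    (memLp_top_inner (memLp_top_gradient hΩ h𝒯 hq) (memLp_top_velocity hΩ hv)).integrable le_top
  rw [eq_neg_iff_add_eq_zero, l2, l2, ← integral_add i1 i2]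
  calc _ = ∫ x in Ω, ∑ i, gradient ((fun x => v x i) * q) x i := by
        refine integral_congr_ae ?_
        filter_upwards [ae_differentiableAt_lagrange hΩ h𝒯 hq,
          ae_all_iff.2 fun i => ae_differentiableAt_lagrange hΩ h𝒯 (hv.1 i)] with x hx hy
        have h1 : ∀ i, gradient ((fun x => v x i) * q) x =
            v x i • gradient q x + q x • gradient (fun x => v x i) x := fun i => by
          simp [gradient, fderiv_mul (hy i) hx]
        simp only [h1, divergence, PiLp.add_apply, PiLp.smul_apply, smul_eq_mul,
          Finset.sum_add_distrib, ← Finset.mul_sum, PiLp.inner_apply]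
        simp [add_comm]
    _ = 0 := by
        rw [integral_finsetSum _ fun i _ =>
          (hcomp i (memLp_top_gradient hΩ h𝒯 (hvq i))).integrable le_top]
        exact Finset.sum_eq_zero fun i _ => h0 i

/-! ### Definite systems and saddle point problems -/

section LinearAlgebra

open Module

/-- A definite bilinear form on a finite dimensional space represents every functional. -/
theorem exists_eq_of_definite {V : Type*} [AddCommGroup V] [Module ℝ V] [FiniteDimensional ℝ V]
    (B : V →ₗ[ℝ] V →ₗ[ℝ] ℝ) (hB : ∀ v, B v v = 0 → v = 0) (f : V →ₗ[ℝ] ℝ) :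
    ∃ u, B u = f := by
  have hinj : Function.Injective B := by
    rw [← LinearMap.ker_eq_bot, LinearMap.ker_eq_bot']
    exact fun v hv => hB v (by rw [hv]; rfl)
  have hdim : finrank ℝ V = finrank ℝ (V →ₗ[ℝ] ℝ) := (Subspace.dual_finrank_eq (K := ℝ)).symm
  exact (LinearMap.injective_iff_surjective_of_finrank_eq_finrank hdim).1 hinj f

/-- Solvability of the discrete projection problem; no inf-sup condition is needed. -/
theorem exists_saddle_point {V Q : Type*} [AddCommGroup V] [Module ℝ V] [FiniteDimensional ℝ V]
    [AddCommGroup Q] [Module ℝ Q] (B : V →ₗ[ℝ] V →ₗ[ℝ] ℝ) (hB : ∀ v, B v v = 0 → v = 0)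
    (g : Q →ₗ[ℝ] V →ₗ[ℝ] ℝ) (f : V →ₗ[ℝ] ℝ) :
    ∃ u q, (∀ v, B u v + g q v = f v) ∧ ∀ q', g q' u = 0 := by
  let Z : Submodule ℝ V := ⨅ q, LinearMap.ker (g q)
  obtain ⟨z, hz⟩ := exists_eq_of_definite (B.compl₁₂ Z.subtype Z.subtype)
    (fun v hv => Subtype.ext (hB v.1 hv)) (f ∘ₗ Z.subtype)
  have hZ : ∀ q, g q z.1 = 0 := fun q => (Submodule.mem_iInf _).1 z.2 q
  -- The residual vanishes on the common kernel `Z` of the constraints, so in finite dimension it is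
  -- a combination of constraint functionals; its multiplier is the pressure, possibly not unique.
  have h1 : f - B z.1 ∈ Submodule.span ℝ (range g) := by
    refine FiniteDimensional.mem_span_of_iInf_ker_le_ker (L := fun q => g q) fun v hv => ?_
    have := congrArg (fun L => L ⟨v, hv⟩) hz
    simp only [LinearMap.compl₁₂_apply, Submodule.subtype_apply, LinearMap.comp_apply] at this
    simp [this]
  rw [← LinearMap.coe_range, Submodule.span_eq] at h1
  obtain ⟨q, hq⟩ := h1
  refine ⟨z.1, q, fun v => ?_, hZ⟩
  rw [hq]
  simp

end LinearAlgebra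

end CHNS

/-! ### Solvability of the three steps -/

namespace CHNS

open MeasureTheory Set Filter Topology Module

variable {d : ℕ} {Ω : Set (Pt d)} {𝒯 : Geometry.SimplicialComplex ℝ (Pt d)} {r k l : ℕ}

theorem IsConvexPolytopalDomain.measureReal_pos (hΩ : IsConvexPolytopalDomain Ω) :
    0 < (volume.restrict Ω).real univ := by
  rw [measureReal_restrict_apply_univ]
  refine ENNReal.toReal_pos (hΩ.isOpen.measure_pos volume hΩ.nonempty).ne' ?_
  exact ((measure_mono subset_closure).trans_lt hΩ.isCompact_closure.measure_lt_top).ne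

/-- The cube of a Lagrange function is a smooth function of its coordinates. -/
theorem exists_cubeMap (hΩ : IsConvexPolytopalDomain Ω) {n : ℕ}
    (e : (Fin n → ℝ) →ₗ[ℝ] lagrangeSubmodule Ω 𝒯 k) :
    ∃ N : (Fin n → ℝ) → Lp ℝ 2 (volume.restrict Ω), ContDiff ℝ 1 N ∧
      ∀ x, N x =ᵐ[volume.restrict Ω] fun y => (e x).1 y * (e x).1 y * (e x).1 y := by
  obtain ⟨J, hJ⟩ := exists_massMap (𝒯 := 𝒯) (k := k + k + k) hΩ
  let b : Fin n → lagrangeSubmodule Ω 𝒯 k := fun i => e (Pi.single i 1)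
  let b₃ : Fin n → Fin n → Fin n → lagrangeSubmodule Ω 𝒯 (k + k + k) := fun i j m =>
    ⟨(b i).1 * (b j).1 * (b m).1, lagrangeSpace_mul (lagrangeSpace_mul (b i).2 (b j).2) (b m).2⟩
  have he : ∀ x y, (e x).1 y = ∑ i, x i * (b i).1 y := by
    intro x y
    have h1 : e x = ∑ i, x i • b i := by
      conv_lhs => rw [pi_eq_sum_univ' x]
      simp [b, map_sum]
    rw [h1]
    simp
  -- Expanding the cube in a basis makes it a polynomial in the coordinates with fixed `L²`
  -- coefficients, so smoothness is immediate.
  refine ⟨fun x => ∑ i, ∑ j, ∑ m, (x i * x j * x m) • J (b₃ i j m), ?_, fun x => ?_⟩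
  · exact ContDiff.sum fun i _ => ContDiff.sum fun j _ => ContDiff.sum fun m _ =>
      (((contDiff_apply ℝ ℝ i).mul (contDiff_apply ℝ ℝ j)).mul (contDiff_apply ℝ ℝ m)).smul
        contDiff_const
  · have h2 : ∑ i, ∑ j, ∑ m, (x i * x j * x m) • J (b₃ i j m) =
        J (∑ i, ∑ j, ∑ m, (x i * x j * x m) • b₃ i j m) := by
      simp [map_sum]
    beta_reduce
    rw [h2]
    refine (hJ _).trans (.of_forall fun y => ?_)
    simp only [he]
    rw [Finset.sum_mul_sum]
    simp only [b₃, Submodule.coe_sum, Submodule.coe_smul, Finset.sum_apply, Pi.smul_apply,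
      smul_eq_mul, Pi.mul_apply]
    rw [Finset.sum_mul]
    refine Finset.sum_congr rfl fun i _ => ?_
    rw [Finset.sum_mul]
    refine Finset.sum_congr rfl fun j _ => ?_
    rw [Finset.mul_sum]
    exact Finset.sum_congr rfl fun m _ => by ring

/-- Quartic coercivity of the cubic nonlinearity on functions of mean zero. -/
theorem cube_coercive (hΩ : IsConvexPolytopalDomain Ω)
    {J : lagrangeSubmodule Ω 𝒯 k →ₗ[ℝ] Lp ℝ 2 (volume.restrict Ω)}
    (hJ : ∀ v, J v =ᵐ[volume.restrict Ω] v.1) {one v : lagrangeSubmodule Ω 𝒯 k}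
    (hone : ∀ x ∈ Ω, one.1 x = 1) {N : Lp ℝ 2 (volume.restrict Ω)}
    (hN : N =ᵐ[volume.restrict Ω] fun x => v.1 x * v.1 x * v.1 x) {a : ℝ}
    (hva : inner ℝ (J (v - a • one)) (J one) = 0) :
    1 / (4 * (volume.restrict Ω).real univ) * ‖J (v - a • one)‖ ^ 4 ≤
      inner ℝ N (J (v - a • one)) := by
  have := hΩ.isFiniteMeasure
  have hmem := ae_restrict_mem (μ := volume) hΩ.isOpen.measurableSet
  have hvol := hΩ.measureReal_pos
  have e2 : J (v - a • one) =ᵐ[volume.restrict Ω] fun x => v.1 x - a := by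
    filter_upwards [hJ (v - a • one), hmem] with x hx hxΩ
    rw [hx]
    simp [hone x hxΩ]
  have e3 : J one =ᵐ[volume.restrict Ω] fun _ => (1 : ℝ) := by
    filter_upwards [hJ one, hmem] with x hx hxΩ
    rw [hx, hone x hxΩ]
  have hi : ∀ s t : ℝ, inner ℝ s t = s * t := fun s t => by simp [mul_comm]
  rw [← l2_eq_inner e2 e3] at hva
  have h4 : ‖J (v - a • one)‖ ^ 4 = (‖J (v - a • one)‖ ^ 2) ^ 2 := by ring
  rw [h4, ← real_inner_self_eq_norm_sq, ← l2_eq_inner e2 e2, ← l2_eq_inner hN e2]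
  have h5 := sq_integral_sq_le_integral_cube_mul hvol
    (memLp_top_lagrange hΩ (coe_mem_lagrangeSpace v)) (c := a) (by simpa [l2] using hva)
  simpa only [l2, hi] using h5

theorem exists_phase_step (c : Params) (hΩ : IsConvexPolytopalDomain Ω)
    (h𝒯 : IsTriangulation 𝒯 Ω) {τ : ℝ} (hτ : 0 < τ) {φ₀ : Pt d → ℝ}
    (hφ₀ : φ₀ ∈ lagrangeSpace Ω 𝒯 r) {u : Pt d → Pt d} (hu : u ∈ velocitySpace Ω 𝒯 r) :
    ∃ φ ∈ lagrangeSpace Ω 𝒯 r, ∃ μ ∈ lagrangeSpace Ω 𝒯 r,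
      (∀ w ∈ lagrangeSpace Ω 𝒯 r, l2 Ω (fun x => (φ x - φ₀ x) / τ) w + bForm Ω φ u w
        + c.M * l2 Ω (gradient μ) (gradient w) = 0) ∧
      ∀ ψ ∈ lagrangeSpace Ω 𝒯 r, l2 Ω μ ψ - c.lam * l2 Ω (gradient φ) (gradient ψ)
        - c.lam / c.ε ^ 2 * l2 Ω (fun x => φ x ^ 3 - φ₀ x) ψ = 0 := by
  have := hΩ.isFiniteMeasure
  have := finiteDimensional_lagrangeSubmodule (k := r) h𝒯
  obtain ⟨J, hJ⟩ := exists_massMap (𝒯 := 𝒯) (k := r) hΩ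
  obtain ⟨G, hG⟩ := exists_gradMap (k := r) hΩ h𝒯
  obtain ⟨D, hD⟩ := exists_transportMap (k := r) hΩ h𝒯 (memLp_top_velocity hΩ hu)
  -- The space of functions carries no norm; coordinates supply the normed space on which the
  -- abstract existence result is applied.
  let e : (Fin (finrank ℝ (lagrangeSubmodule Ω 𝒯 r)) → ℝ) ≃ₗ[ℝ] lagrangeSubmodule Ω 𝒯 r :=
    (finBasis ℝ (lagrangeSubmodule Ω 𝒯 r)).equivFun.symm
  obtain ⟨N, hNd, hN⟩ := exists_cubeMap hΩ e.toLinearMap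
  let one : lagrangeSubmodule Ω 𝒯 r := ⟨_, indicator_one_mem_lagrangeSpace h𝒯⟩
  have hone : ∀ x ∈ Ω, one.1 x = 1 := fun x hx => indicator_of_mem (subset_closure hx) _
  have hvol := hΩ.measureReal_pos
  have hgone : ∀ x ∈ Ω, gradient one.1 x = 0 := by
    intro x hx
    have h1 : one.1 =ᶠ[𝓝 x] fun _ => 1 := by
      filter_upwards [hΩ.isOpen.mem_nhds hx] with y hy using hone y hy
    rw [gradient, h1.fderiv_eq]
    simp
  have hmem := ae_restrict_mem (μ := volume) hΩ.isOpen.measurableSet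
  have hι : Function.Injective fun x => J (e x) := (massMap_injective hΩ hJ).comp e.injective
  obtain ⟨x, y, h1, h2⟩ := exists_phaseField_solution
    (ι := LinearMap.toContinuousLinearMap (J ∘ₗ e.toLinearMap))
    (G := LinearMap.toContinuousLinearMap (G ∘ₗ e.toLinearMap))
    (D := LinearMap.toContinuousLinearMap (D ∘ₗ e.toLinearMap))
    (N := N) (one := e.symm one) (τ := τ) (M := c.M) (lam := c.lam) (γ := c.lam / c.ε ^ 2)
    (κ := 1 / (4 * (volume.restrict Ω).real univ))
    hι (fun v hv => by
      have hv' : G (e v) = 0 := hv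
      have h1 := hG (e v)
      rw [hv'] at h1
      obtain ⟨a, ha⟩ := lagrange_eq_const_of_gradient_ae_zero hΩ h𝒯 (e v).2
        (h1.symm.trans (Lp.coeFn_zero _ _ _))
      refine ⟨a, e.injective ?_⟩
      rw [map_smul, e.apply_symm_apply]
      exact Subtype.ext ha)
    (by
      change G (e (e.symm one)) = 0
      rw [e.apply_symm_apply]
      refine Lp.ext ((hG one).trans (.trans ?_ (Lp.coeFn_zero _ _ _).symm))
      filter_upwards [hmem] with x hx using hgone x hx)
    (by
      rw [Ne, e.symm.map_eq_zero_iff]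
      intro h
      obtain ⟨x, hx⟩ := hΩ.nonempty
      have := hone x hx
      rw [h] at this
      exact zero_ne_one this)
    (by
      change D (e (e.symm one)) = 0
      rw [e.apply_symm_apply]
      refine Lp.ext ((hD one).trans (.trans ?_ (Lp.coeFn_zero _ _ _).symm))
      filter_upwards [hmem] with x hx
      rw [hgone x hx, inner_zero_left]
      rfl)
    hNd (by positivity)
    (fun v a hva => by
      change inner ℝ (J (e (v - a • e.symm one))) (J (e (e.symm one))) = 0 at hva
      change _ * ‖J (e (v - a • e.symm one))‖ ^ 4 ≤ inner ℝ (N v) (J (e (v - a • e.symm one)))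
      have e1 : e (v - a • e.symm one) = e v - a • one := by simp
      rw [e.apply_symm_apply] at hva
      rw [e1] at hva ⊢
      exact cube_coercive hΩ hJ hone (hN v) hva)
    hτ c.M_pos c.lam_pos (div_pos c.lam_pos (pow_pos c.ε_pos 2)) (J ⟨φ₀, hφ₀⟩)
  refine ⟨(e x).1, (e x).2, (e y).1, (e y).2, fun w hw => ?_, fun ψ hψ => ?_⟩
  · have h3 := h1 (e.symm ⟨w, hw⟩)
    simp only [LinearMap.coe_toContinuousLinearMap', LinearMap.comp_apply, LinearEquiv.coe_coe,
      e.apply_symm_apply] at h3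
    have t1 : l2 Ω (fun z => ((e x).1 z - φ₀ z) / τ) w =
        inner ℝ (τ⁻¹ • (J (e x) - J ⟨φ₀, hφ₀⟩)) (J ⟨w, hw⟩) := by
      refine l2_eq_inner ?_ (hJ ⟨w, hw⟩)
      filter_upwards [Lp.coeFn_smul τ⁻¹ (J (e x) - J ⟨φ₀, hφ₀⟩),
        Lp.coeFn_sub (J (e x)) (J ⟨φ₀, hφ₀⟩), hJ (e x), hJ ⟨φ₀, hφ₀⟩] with z h4 h5 h6 h7
      rw [h4, Pi.smul_apply, h5, Pi.sub_apply, h6, h7, smul_eq_mul, div_eq_inv_mul]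
    have t2 : bForm Ω (e x).1 u w = inner ℝ (D (e x)) (J ⟨w, hw⟩) :=
      l2_eq_inner (hD (e x)) (hJ ⟨w, hw⟩)
    have t3 : l2 Ω (gradient (e y).1) (gradient w) = inner ℝ (G (e y)) (G ⟨w, hw⟩) :=
      l2_eq_inner (hG (e y)) (hG ⟨w, hw⟩)
    rw [t1, t2, t3]
    exact h3
  · have h3 := h2 (e.symm ⟨ψ, hψ⟩)
    simp only [LinearMap.coe_toContinuousLinearMap', LinearMap.comp_apply, LinearEquiv.coe_coe,
      e.apply_symm_apply] at h3
    have t1 : l2 Ω (fun z => (e x).1 z ^ 3 - φ₀ z) ψ =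
        inner ℝ (N x - J ⟨φ₀, hφ₀⟩) (J ⟨ψ, hψ⟩) := by
      refine l2_eq_inner ?_ (hJ ⟨ψ, hψ⟩)
      filter_upwards [Lp.coeFn_sub (N x) (J ⟨φ₀, hφ₀⟩), hN x, hJ ⟨φ₀, hφ₀⟩] with z h5 h6 h7
      rw [h5, Pi.sub_apply, h6, h7]
      simp only [LinearEquiv.coe_coe]
      ring
    have t2 : l2 Ω (e y).1 ψ = inner ℝ (J (e y)) (J ⟨ψ, hψ⟩) :=
      l2_eq_inner (hJ (e y)) (hJ ⟨ψ, hψ⟩)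
    have t3 : l2 Ω (gradient (e x).1) (gradient ψ) = inner ℝ (G (e x)) (G ⟨ψ, hψ⟩) :=
      l2_eq_inner (hG (e x)) (hG ⟨ψ, hψ⟩)
    rw [t1, t2, t3]
    exact h3

theorem exists_momentum_step (c : Params) (hΩ : IsConvexPolytopalDomain Ω)
    (h𝒯 : IsTriangulation 𝒯 Ω) {τ : ℝ} (hτ : 0 < τ) {u : Pt d → Pt d}
    (hu : u ∈ velocitySpace Ω 𝒯 r) {p φ μ : Pt d → ℝ} (hp : p ∈ lagrangeSpace Ω 𝒯 l)
    (hφ : φ ∈ lagrangeSpace Ω 𝒯 r) (hμ : μ ∈ lagrangeSpace Ω 𝒯 r) :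
    ∃ ut ∈ velocitySpace Ω 𝒯 r, ∀ v ∈ velocitySpace Ω 𝒯 r,
      l2 Ω (fun x => τ⁻¹ • (ut x - u x)) v + BForm Ω u ut v + c.ν * l2GradVec Ω ut v
        + l2 Ω (gradient p) v - bForm Ω φ v μ = 0 := by
  have := finiteDimensional_velocitySubmodule (k := r) h𝒯
  obtain ⟨J, hJ⟩ := exists_massMap (𝒯 := 𝒯) (k := r) hΩ
  obtain ⟨G, hG⟩ := exists_gradMap (k := r) hΩ h𝒯
  obtain ⟨Gp, hGp⟩ := exists_gradMap (k := l) hΩ h𝒯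
  obtain ⟨I, hI⟩ := exists_velocityMap (𝒯 := 𝒯) (k := r) hΩ
  obtain ⟨A, hA⟩ := exists_convectMap (k := r) hΩ h𝒯 (memLp_top_velocity hΩ hu)
  obtain ⟨P, hP⟩ := exists_pairingMap (𝒯 := 𝒯) (k := r) hΩ (memLp_top_gradient hΩ h𝒯 hφ)
  let H := Lp (Pt d) 2 (volume.restrict Ω)
  let g : Fin d → velocitySubmodule Ω 𝒯 r →ₗ[ℝ] H := fun i => G ∘ₗ velocityComponent Ω 𝒯 r i
  let B : velocitySubmodule Ω 𝒯 r →ₗ[ℝ] velocitySubmodule Ω 𝒯 r →ₗ[ℝ] ℝ :=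
    τ⁻¹ • (innerₗ H).compl₁₂ I I + (1 / 2 : ℝ) • (innerₗ H).compl₁₂ A I
      - (1 / 2 : ℝ) • (innerₗ H).compl₁₂ I A + c.ν • ∑ i, (innerₗ H).compl₁₂ (g i) (g i)
  let f : velocitySubmodule Ω 𝒯 r →ₗ[ℝ] ℝ :=
    innerₗ H (τ⁻¹ • I ⟨u, hu⟩ - Gp ⟨p, hp⟩) ∘ₗ I + innerₗ _ (J ⟨μ, hμ⟩) ∘ₗ P
  have hB : ∀ v w, B v w = τ⁻¹ * inner ℝ (I v) (I w) + 1 / 2 * inner ℝ (A v) (I w)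
      - 1 / 2 * inner ℝ (I v) (A w) + c.ν * ∑ i, inner ℝ (g i v) (g i w) := fun v w => by
    simp [B]
  -- On the diagonal the two convective halves cancel, without any divergence condition on `u`. The
  -- viscous part is nonnegative, so the mass term must vanish.
  obtain ⟨ut, hut⟩ := exists_eq_of_definite B (fun v hv => by
    have hτ' : 0 < τ⁻¹ := inv_pos.2 hτ
    rw [hB, real_inner_comm (I v) (A v)] at hv
    rw [real_inner_self_eq_norm_sq (I v)] at hv
    have h1 : 0 ≤ c.ν * ∑ i, inner ℝ (g i v) (g i v) :=
      mul_nonneg c.ν_pos.le (Finset.sum_nonneg fun i _ => real_inner_self_nonneg)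
    have h2 : 0 ≤ τ⁻¹ * ‖I v‖ ^ 2 := by positivity
    have h3 : τ⁻¹ * ‖I v‖ ^ 2 = 0 := by linarith
    have h4 : I v = 0 := by simpa [hτ.ne'] using h3
    exact (map_eq_zero_iff I (velocityMap_injective hΩ hI)).1 h4) f
  refine ⟨ut.1, ut.2, fun v hv => ?_⟩
  have h1 := congrArg (fun L => L ⟨v, hv⟩) hut
  simp only [hB] at h1
  have h2 : l2 Ω (fun x => τ⁻¹ • (ut.1 x - u x)) v =
      inner ℝ (τ⁻¹ • (I ut - I ⟨u, hu⟩)) (I ⟨v, hv⟩) := by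
    refine l2_eq_inner ?_ (hI ⟨v, hv⟩)
    filter_upwards [Lp.coeFn_smul τ⁻¹ (I ut - I ⟨u, hu⟩), Lp.coeFn_sub (I ut) (I ⟨u, hu⟩),
      hI ut, hI ⟨u, hu⟩] with z h4 h5 h6 h7
    rw [h4, Pi.smul_apply, h5, Pi.sub_apply, h6, h7]
  have h3 : l2GradVec Ω ut.1 v = ∑ i, inner ℝ (g i ut) (g i ⟨v, hv⟩) :=
    Finset.sum_congr rfl fun i _ => l2_eq_inner (hG _) (hG _)
  have h4 : f ⟨v, hv⟩ = τ⁻¹ * inner ℝ (I ⟨u, hu⟩) (I ⟨v, hv⟩)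
      - inner ℝ (Gp ⟨p, hp⟩) (I ⟨v, hv⟩) + inner ℝ (P ⟨v, hv⟩) (J ⟨μ, hμ⟩) := by
    simp only [f, LinearMap.add_apply, LinearMap.comp_apply, innerₗ_apply_apply, inner_sub_left,
      real_inner_smul_left]
    rw [real_inner_comm (J ⟨μ, hμ⟩)]
  rw [h2, h3, BForm, bForm, l2_eq_inner (hA ut) (hI ⟨v, hv⟩), l2_eq_inner (hA ⟨v, hv⟩) (hI ut),
    l2_eq_inner (hGp ⟨p, hp⟩) (hI ⟨v, hv⟩), l2_eq_inner (hP ⟨v, hv⟩) (hJ ⟨μ, hμ⟩),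
    real_inner_smul_left, inner_sub_left, real_inner_comm (I ut)]
  rw [h4] at h1
  linarith

/-- The pressure space as a vector space. -/
def pressureSubmodule (𝒯 : Geometry.SimplicialComplex ℝ (Pt d)) (l : ℕ)
    (hΩ : IsConvexPolytopalDomain Ω) : Submodule ℝ (lagrangeSubmodule Ω 𝒯 l) where
  carrier := {q | ∫ x in Ω, q.1 x = 0}
  add_mem' := fun {a b} ha hb => by
    have := hΩ.isFiniteMeasure
    have h1 : ∫ x in Ω, (a.1 x + b.1 x) = _ := integral_add
      ((memLp_top_lagrange hΩ a.2).integrable le_top)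
      ((memLp_top_lagrange hΩ b.2).integrable le_top)
    have ha' : ∫ x in Ω, a.1 x = 0 := ha
    have hb' : ∫ x in Ω, b.1 x = 0 := hb
    rw [ha', hb', add_zero] at h1
    exact h1
  zero_mem' := by simp
  smul_mem' := fun a b hb => by
    have h1 : ∫ x in Ω, a * b.1 x = _ := integral_const_mul a b.1
    have hb' : ∫ x in Ω, b.1 x = 0 := hb
    rw [hb', mul_zero] at h1
    exact h1

theorem exists_projection_step (hΩ : IsConvexPolytopalDomain Ω)
    (h𝒯 : IsTriangulation 𝒯 Ω) {τ : ℝ} (hτ : 0 < τ) {ut : Pt d → Pt d}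
    (hut : ut ∈ velocitySpace Ω 𝒯 r) {p₀ : Pt d → ℝ} (hp₀ : p₀ ∈ pressureSpace Ω 𝒯 l) :
    ∃ u ∈ velocitySpace Ω 𝒯 r, ∃ p ∈ pressureSpace Ω 𝒯 l,
      (∀ v ∈ velocitySpace Ω 𝒯 r, l2 Ω (fun x => τ⁻¹ • (u x - ut x)) v
        + l2 Ω (gradient fun x => p x - p₀ x) v = 0) ∧
      ∀ q ∈ pressureSpace Ω 𝒯 l, l2 Ω (divergence u) q = 0 := by
  have := hΩ.isFiniteMeasure
  have := finiteDimensional_velocitySubmodule (k := r) h𝒯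
  obtain ⟨G, hG⟩ := exists_gradMap (k := l) hΩ h𝒯
  obtain ⟨I, hI⟩ := exists_velocityMap (𝒯 := 𝒯) (k := r) hΩ
  let H := Lp (Pt d) 2 (volume.restrict Ω)
  let Q := pressureSubmodule 𝒯 l hΩ
  -- The multiplier `q` is the pressure increment, and the constraint is orthogonality of `u` to
  -- discrete pressure gradients; integration by parts turns it into discrete incompressibility.
  obtain ⟨u, q, h1, h2⟩ := exists_saddle_point
    (V := velocitySubmodule Ω 𝒯 r) (Q := Q) (τ⁻¹ • (innerₗ H).compl₁₂ I I) (fun v hv => by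
      have h3 : τ⁻¹ * inner ℝ (I v) (I v) = 0 := hv
      have h4 : I v = 0 := by simpa [hτ.ne'] using h3
      exact (map_eq_zero_iff I (velocityMap_injective hΩ hI)).1 h4)
    ((innerₗ H).compl₁₂ (G ∘ₗ Q.subtype) I) (innerₗ H (τ⁻¹ • I ⟨ut, hut⟩) ∘ₗ I)
  have hqp : p₀ + q.1.1 ∈ pressureSpace Ω 𝒯 l := by
    refine ⟨lagrangeSpace_add hp₀.1 q.1.2, ?_⟩
    have h3 : ∫ x in Ω, (p₀ x + q.1.1 x) = _ := integral_add 
      ((memLp_top_lagrange hΩ hp₀.1).integrable le_top)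
      ((memLp_top_lagrange hΩ q.1.2).integrable le_top)
    rw [hp₀.2, show ∫ x in Ω, q.1.1 x = 0 from q.2, add_zero] at h3
    exact h3
  refine ⟨u.1, u.2, _, hqp, fun v hv => ?_, fun q' hq' => ?_⟩
  · have h3 : (fun x => (p₀ + q.1.1) x - p₀ x) = q.1.1 := by
      ext x
      simp
    have h4 : l2 Ω (fun x => τ⁻¹ • (u.1 x - ut x)) v =
        inner ℝ (τ⁻¹ • (I u - I ⟨ut, hut⟩)) (I ⟨v, hv⟩) := by
      refine l2_eq_inner ?_ (hI ⟨v, hv⟩)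
      filter_upwards [Lp.coeFn_smul τ⁻¹ (I u - I ⟨ut, hut⟩), Lp.coeFn_sub (I u) (I ⟨ut, hut⟩),
        hI u, hI ⟨ut, hut⟩] with z h4 h5 h6 h7
      rw [h4, Pi.smul_apply, h5, Pi.sub_apply, h6, h7]
    have h5 : τ⁻¹ * inner ℝ (I u) (I ⟨v, hv⟩) + inner ℝ (G q.1) (I ⟨v, hv⟩) =
        inner ℝ (τ⁻¹ • I ⟨ut, hut⟩) (I ⟨v, hv⟩) := h1 ⟨v, hv⟩
    rw [h3, h4, l2_eq_inner (hG q.1) (hI ⟨v, hv⟩), smul_sub, inner_sub_left,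
      real_inner_smul_left (I u)]
    linarith
  · have h3 : inner ℝ (G ⟨q', hq'.1⟩) (I u) = 0 := h2 ⟨⟨q', hq'.1⟩, hq'.2⟩
    rw [l2_divergence_eq_neg hΩ h𝒯 u.2 hq'.1, l2_eq_inner (hG ⟨q', hq'.1⟩) (hI u), h3, neg_zero]

theorem exists_isStep (c : Params) (hΩ : IsConvexPolytopalDomain Ω) (h𝒯 : IsTriangulation 𝒯 Ω)
    {τ : ℝ} (hτ : 0 < τ) {U : Level d} (hU : U.Mem Ω 𝒯 r) :
    ∃ ut V, IsStep c Ω 𝒯 r τ U ut V := by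
  obtain ⟨φ, hφ, μ, hμ, h1, h2⟩ := exists_phase_step c hΩ h𝒯 hτ hU.φ_mem hU.u_mem
  obtain ⟨ut, hut, h3⟩ := exists_momentum_step c hΩ h𝒯 hτ hU.u_mem hU.p_mem.1 hφ hμ
  obtain ⟨u, hu, p, hp, h4, h5⟩ := exists_projection_step hΩ h𝒯 hτ hut hU.p_mem
  exact ⟨ut, ⟨φ, μ, u, p⟩, ⟨hφ, hμ, hu, hp⟩, hut, h1, h2, h3, h4, h5⟩

end CHNS

/-! ### Iteration over the time levels -/

theorem mainTheorem4 (d : ℕ) (hd : d = 2 ∨ d = 3) (c : CHNS.Params)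
    (Ω : Set (CHNS.Pt d)) (hΩ : CHNS.IsConvexPolytopalDomain Ω)
    (𝒯 : Geometry.SimplicialComplex ℝ (CHNS.Pt d)) (h𝒯 : CHNS.IsTriangulation 𝒯 Ω)
    (r : ℕ) (hr : 2 ≤ r) (U₀ : CHNS.Level d) (hU₀ : U₀.Mem Ω 𝒯 r)
    (C : ℝ)
    (hC : (∫ x in Ω, CHNS.potential c.ε (U₀.φ x)) + CHNS.h1Norm Ω U₀.φ
      + CHNS.l2Norm Ω U₀.u ≤ C)
    (τ : ℝ) (hτ : 0 < τ) :
    (∀ (n : ℕ) (U : ℕ → CHNS.Level d), U 0 = U₀ →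
      (∀ k < n, ∃ ut, CHNS.IsStep c Ω 𝒯 r τ (U k) ut (U (k + 1))) →
      ∃ (ut : CHNS.Pt d → CHNS.Pt d) (V : CHNS.Level d), CHNS.IsStep c Ω 𝒯 r τ (U n) ut V) ∧
    ∃ (U : ℕ → CHNS.Level d) (ut : ℕ → CHNS.Pt d → CHNS.Pt d), U 0 = U₀ ∧
      ∀ n, CHNS.IsStep c Ω 𝒯 r τ (U n) (ut (n + 1)) (U (n + 1)) := by
  refine ⟨fun n U hU0 hU => ?_, ?_⟩
  · refine CHNS.exists_isStep c hΩ h𝒯 hτ ?_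
    cases n with
    | zero => rwa [hU0]
    | succ n =>
      obtain ⟨_, h⟩ := hU n n.lt_succ_self
      exact h.mem
  -- Membership in the discrete spaces is all that a step requires of the previous level, and a step
  -- reproduces it, so the recursion runs on the subtype.
  · have hstep : ∀ U : {U : CHNS.Level d // U.Mem Ω 𝒯 r}, ∃ (V : {U : CHNS.Level d // U.Mem Ω 𝒯 r})
        (ut : CHNS.Pt d → CHNS.Pt d), CHNS.IsStep c Ω 𝒯 r τ U.1 ut V.1 := fun U => by
      obtain ⟨ut, V, h⟩ := CHNS.exists_isStep c hΩ h𝒯 hτ U.2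
      exact ⟨⟨V, h.mem⟩, ut, h⟩
    choose next vel hnext using hstep
    let W : ℕ → {U : CHNS.Level d // U.Mem Ω 𝒯 r} := fun n => n.rec ⟨U₀, hU₀⟩ fun _ U => next U
    -- The intermediate velocity with index `n + 1` is computed from level `n`; its value at index
    -- `0` is arbitrary.
    exact ⟨fun n => (W n).1, fun n => vel (W (n - 1)), rfl, fun n => hnext (W n)⟩
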